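/- For $x=(x_1,x_2)^T\in\mathbb R^2$ put $x^\perp=(-x_2,x_1)^T$, for $u,v\in\mathbb R^2$ let $u\otimes v=(u_jv_k)_{j,k}$, and let $|\cdot|$ be the Euclidean norm on $\mathbb R^2$ and the Frobenius norm on $2\times2$ matrices. Let $$O(t)=\begin{pmatrix}\cos t&-\sin t\\ \sin t&\cos t\end{pmatrix},\qquad G(x,t)=\frac{1}{4\pi t}e^{-|x|^2/4t},$$ $$K(x,t)=G(x,t)\,\mathbb I+H(x,t),\qquad H(x,t)=\int_t^\infty\nabla^2G(x,s)\,ds=\int_t^\infty G(x,s)\Big(\frac{x\otimes x}{4s^2}-\frac{\mathbb I}{2s}\Big)ds ,$$ and for $a\in\mathbb R\setminus\{0\}$ let $$\Gamma_a(x,y)=\int_0^\infty O(at)^TK(O(at)x-y,t)\,dt$$ be the velocity part of the fundamental solution in the whole plane of the rotating Stokes system $-\Delta u-a(x^\perp\cdot\nabla u-u^\perp)+\nabla p=f$, $\operatorname{div}u=0$. (0) For every $a\neq0$ and all $x\neq y$ this integral converges conditionally: the integrand is integrable on $(0,T)$ for every $T>0$, the limit of $\int_0^T$ as $T\to\infty$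 exists (and is $\Gamma_a(x,y)$), but $\int_0^\infty|O(at)^TK(O(at)x-y,t)|\,dt=\infty$. (1) There is a constant $C>0$ independent of $a\in\mathbb R\setminus\{0\}$ such that $$\left|\Gamma_a(x,y)-\frac{x^\perp\otimes y^\perp}{4\pi|x|^2}\right|\le\frac{C(|a|^{-1}+|y|^2)}{|x|^2}\qquad\text{for all }(x,y)\in\mathbb R^2\times\mathbb R^2\text{ with }|x|>2|y|.$$ In particular, for every fixed $a\ne0$ and $\rho>0$, $\Gamma_a(x,y)=\dfrac{x^\perp\otimes y^\perp}{4\pi|x|^2}+O(|x|^{-2})$ as $|x|\to\infty$, uniformly in $|y|\le\rho$. (2) There is a constant $C>0$ independent of $a\in\mathbb R\setminus\{0\}$ such that $$\left|\Gamma_a(x,y)-\frac{x^\perp\otimes y^\perp}{4\pi|y|^2}\right|\le\frac{C(|a|^{-1}+|x|^2)}{|y|^2}\qquad\text{for all }(x,y)\in\mathbb R^2\times\mathbb R^2\text{ with }|y|>2|x|.$$ -/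

import Mathlib

open MeasureTheory Filter Topology Set Asymptotics
open scoped Matrix

-- The Frobenius norm serves as the norm `|A|` of a `2 × 2` matrix.
attribute [local instance] Matrix.frobeniusNormedAddCommGroup

noncomputable section

namespace RotStokes

/-- The Euclidean plane. -/
abbrev Plane : Type := EuclideanSpace ℝ (Fin 2)

/-- Real `2 × 2` matrices. -/
abbrev Mat : Type := Matrix (Fin 2) (Fin 2) ℝ

/-- `x^⊥ = (-x₂, x₁)`. -/
def perp (x : Plane) : Plane := !₂[-x 1, x 0]

/-- `u ⊗ v = (u_j v_k)`. -/
def tensor (u v : Plane) : Mat := Matrix.vecMulVec u.ofLp v.ofLp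

/-- The rotation matrix `O(t)`. -/
def rot (t : ℝ) : Mat := !![Real.cos t, -Real.sin t; Real.sin t, Real.cos t]

/-- The action of a matrix on a vector of the plane. -/
def act (A : Mat) (x : Plane) : Plane := WithLp.toLp 2 (A *ᵥ x.ofLp)

/-- The two-dimensional heat kernel `G(x,t) = (4πt)⁻¹ exp(-|x|²/(4t))`. -/
def heatKernel (x : Plane) (t : ℝ) : ℝ :=
  1 / (4 * Real.pi * t) * Real.exp (-‖x‖ ^ 2 / (4 * t))

/-- The Hessian in `x` of the heat kernel,
`∇²G(x,s) = G(x,s) (x ⊗ x / (4s²) - I / (2s))`. -/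
def heatHessian (x : Plane) (s : ℝ) : Mat :=
  heatKernel x s • ((1 / (4 * s ^ 2)) • tensor x x - (1 / (2 * s)) • (1 : Mat))

/-- `H(x,t) = ∫_t^∞ ∇²G(x,s) ds`, the integral being taken entry by entry. -/
def stokesH (x : Plane) (t : ℝ) : Mat :=
  Matrix.of fun i j => ∫ s in Ioi t, heatHessian x s i j

/-- The fundamental solution `K(x,t) = G(x,t) I + H(x,t)` of the unsteady Stokes system. -/
def stokesK (x : Plane) (t : ℝ) : Mat := heatKernel x t • (1 : Mat) + stokesH x t

/-- The integrand `O(at)ᵀ K(O(at)x - y, t)`. -/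
def integrand (a : ℝ) (x y : Plane) (t : ℝ) : Mat :=
  (rot (a * t))ᵀ * stokesK (act (rot (a * t)) x - y) t

/-- The improper integral `Γ_a(x,y) = ∫_0^∞ O(at)ᵀ K(O(at)x - y, t) dt`, that is, entry by entry
the limit of `∫_0^T` as `T → ∞`. -/
def Gam (a : ℝ) (x y : Plane) : Mat :=
  Matrix.of fun i j => limUnder atTop fun T : ℝ => ∫ t in (0 : ℝ)..T, integrand a x y t i j

end RotStokes

end

/-! Identify the plane with ℂ and write a real 2×2 matrix as v ↦ p v + q v̄. The rotation O(at)
becomes multiplication by e^{iat}, and integrating the heat kernel by parts in time collapses K(z,t)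
to p = G/2 and q = z² ∫_t^∞ s⁻³ e^{-|z|²/4s} ds / (32π) (`stokesK_eq`). The integrand of Γ_a
therefore has two scalar coefficients, `linPart` and `antiPart`, which depend on t through the phase
e^{iat} and through |e^{iat}x - y|² = R - d(t). Here R = |x|² + |y|² and d = e^{iat}xȳ + e^{-iat}x̄y
is the deviation.

Convergence: `antiPart` is O(t⁻²). `linPart` has modulus of order 1/t, so absolute convergence
fails, but it differs by O(t⁻²) from e^{-iat} t⁻¹ e^{-1/4t}, whose integral converges by
oscillation.

Asymptotics for |x| > 2|y|: expand both coefficients in d around R. Terms that keep a phase e^{±iat}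
or e^{±2iat} integrate to O(|a|⁻¹|x|⁻²) after one integration by parts (`norm_integral_cis_mul_le`).
The Taylor remainders are integrable, with integral O(|y|²/|x|²). In the resonant terms the phase of
d cancels the prefactor. They integrate exactly to xȳ/R and 4|x|²xy/R² - 8xy/R, which up to
O(|y|²/|x|²) are xȳ/|x|² and -4xy/|x|². These are the two coefficients of x^⊥ ⊗ y^⊥/(4π|x|²)
(`leading_eq`).

The region |y| > 2|x| follows from the symmetry Γ_{-a}(y,x)ᵀ = Γ_a(x,y) (`Gam_neg_swap`). -/

namespace RotStokes

/-! ### Gaussian moments in time and their tails -/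

/-- The function `t⁻ᵏ exp(-R/(4t))`. -/
noncomputable def mom (k : ℕ) (R t : ℝ) : ℝ := (t⁻¹) ^ k * Real.exp (-(R * t⁻¹ / 4))

/-- The tail integral `∫_t^∞ s⁻ᵏ exp(-R/(4s)) ds`. -/
noncomputable def tail (k : ℕ) (R t : ℝ) : ℝ := ∫ s in Ioi t, mom k R s

lemma hasDerivAt_mom (k : ℕ) (R : ℝ) {t : ℝ} (ht : 0 < t) :
    HasDerivAt (mom k R) (R / 4 * mom (k + 2) R t - k * mom (k + 1) R t) t := by
  have h1 := hasDerivAt_inv ht.ne'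
  have h2 := (h1.fun_pow k).mul ((((h1.const_mul R).div_const 4).fun_neg).exp)
  refine h2.congr_deriv ?_
  rcases k with _ | k
  · simp [mom]; field_simp
  · simp only [mom, Nat.add_sub_cancel]
    push_cast
    rw [show (t ^ 2)⁻¹ = t⁻¹ ^ 2 by rw [inv_pow]]
    ring

lemma continuousOn_mom (k : ℕ) (R : ℝ) : ContinuousOn (mom k R) (Ioi 0) := fun _ ht =>
  (hasDerivAt_mom k R ht).continuousAt.continuousWithinAt

lemma mom_nonneg (k : ℕ) (R : ℝ) {t : ℝ} (ht : 0 < t) : 0 ≤ mom k R t := by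
  unfold mom; positivity

lemma mom_anti (k : ℕ) {R S t : ℝ} (h : R ≤ S) (ht : 0 < t) : mom k S t ≤ mom k R t := by
  unfold mom; gcongr

lemma mom_le_inv (k : ℕ) {R t : ℝ} (hR : 0 ≤ R) (ht : 0 < t) : mom k R t ≤ (t⁻¹) ^ k := by
  have := mom_anti k hR ht
  simpa [mom] using this

lemma mom_succ (k : ℕ) (R : ℝ) {t : ℝ} (ht : 0 < t) : mom k R t = t * mom (k + 1) R t := by
  unfold mom; rw [pow_succ]; field_simp

/-- This is u^k/k! ≤ e^u at u = R/(4t). The bound is uniform in t, so it controls the singularity at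
t = 0. -/
lemma mom_le (k : ℕ) {R t : ℝ} (hR : 0 < R) (ht : 0 < t) :
    mom k R t ≤ k.factorial * (4 / R) ^ k := by
  have h := Real.pow_div_factorial_le_exp (R * t⁻¹ / 4) (by positivity) k
  rw [div_le_iff₀ (by positivity)] at h
  have e : (t⁻¹) ^ k = (4 / R) ^ k * (R * t⁻¹ / 4) ^ k := by
    rw [← mul_pow]; congr 1; field_simp
  unfold mom
  rw [e, Real.exp_neg, ← div_eq_mul_inv, div_le_iff₀ (Real.exp_pos _)]
  calc _ ≤ (4 / R) ^ k * (Real.exp (R * t⁻¹ / 4) * k.factorial) := by gcongr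
    _ = _ := by ring

lemma tendsto_mom_zero (k : ℕ) {R : ℝ} (hR : 0 < R) : Tendsto (mom k R) (𝓝[>] 0) (𝓝 0) := by
  have h : Tendsto (fun t : ℝ => t * ((k + 1).factorial * (4 / R) ^ (k + 1))) (𝓝[>] 0) (𝓝 0) := by
    have : Continuous fun t : ℝ => t * ((k + 1).factorial * (4 / R) ^ (k + 1)) := by fun_prop
    simpa using (this.tendsto 0).mono_left nhdsWithin_le_nhds
  refine squeeze_zero' ?_ ?_ h
  · filter_upwards [self_mem_nhdsWithin] with t ht using mom_nonneg k R ht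
  · filter_upwards [self_mem_nhdsWithin] with t ht
    rw [mom_succ k R ht]
    exact mul_le_mul_of_nonneg_left (mom_le _ hR ht) (le_of_lt ht)

lemma tendsto_mom_atTop (k : ℕ) {R : ℝ} (hR : 0 ≤ R) :
    Tendsto (mom (k + 1) R) atTop (𝓝 0) := by
  have h : Tendsto (fun t : ℝ => (t⁻¹) ^ (k + 1)) atTop (𝓝 0) := by
    simpa using (tendsto_inv_atTop_zero (𝕜 := ℝ)).pow (k + 1)
  refine squeeze_zero' ?_ ?_ h
  · filter_upwards [eventually_gt_atTop 0] with t ht using mom_nonneg _ R ht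
  · filter_upwards [eventually_gt_atTop 0] with t ht using mom_le_inv _ hR ht

lemma tendsto_mom_zero_atTop (R : ℝ) : Tendsto (mom 0 R) atTop (𝓝 1) := by
  have h : Continuous fun u : ℝ => u ^ 0 * Real.exp (-(R * u / 4)) := by fun_prop
  have h' := (h.tendsto 0).comp (tendsto_inv_atTop_zero (𝕜 := ℝ))
  simp only [pow_zero, mul_zero, zero_div, neg_zero, Real.exp_zero, mul_one] at h'
  exact h'

/-- A nonnegative function on the half line is integrable if it has a primitive with limits
at both ends. -/
lemma integral_Ioi_of_primitive {A f : ℝ → ℝ} {l m : ℝ} (hd : ∀ t, 0 < t → HasDerivAt A (f t) t)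
    (hf : ∀ t, 0 < t → 0 ≤ f t) (h0 : Tendsto A (𝓝[>] 0) (𝓝 l)) (h1 : Tendsto A atTop (𝓝 m)) :
    IntegrableOn f (Ioi 0) ∧ ∫ t in Ioi (0 : ℝ), f t = m - l := by
  -- `A` has only a one-sided limit at 0, and its value there is irrelevant; it is replaced by `l`
  -- to obtain continuity on the closed half line.
  have hc : ContinuousWithinAt (Function.update A 0 l) (Ici 0) 0 := by
    rw [continuousWithinAt_update_same, Ici_sdiff_left]; exact h0
  have hd' : ∀ t ∈ Ioi (0 : ℝ), HasDerivAt (Function.update A 0 l) (f t) t := by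
    intro t ht
    refine (hd t ht).congr_of_eventuallyEq ?_
    filter_upwards [Ioi_mem_nhds ht] with s hs
    rw [Function.update_of_ne (ne_of_gt hs)]
  have h1' : Tendsto (Function.update A 0 l) atTop (𝓝 m) := by
    refine h1.congr' ?_
    filter_upwards [eventually_gt_atTop 0] with s hs
    rw [Function.update_of_ne (ne_of_gt hs)]
  refine ⟨integrableOn_Ioi_deriv_of_nonneg hc hd' hf h1', ?_⟩
  simpa using integral_Ioi_of_hasDerivAt_of_nonneg hc hd' hf h1'

/-- Induction through `hasDerivAt_mom`: the derivative of `mom (k + 1) R` links the moments of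
orders k + 2 and k + 3, so a primitive of one yields a primitive of the next. The limit at infinity
is Euler's integral for k!. -/
lemma exists_primitive_mom (k : ℕ) {R : ℝ} (hR : 0 < R) :
    ∃ A : ℝ → ℝ, (∀ t, 0 < t → HasDerivAt A (mom (k + 2) R t) t) ∧ Tendsto A (𝓝[>] 0) (𝓝 0) ∧
      Tendsto A atTop (𝓝 (k.factorial * (4 / R) ^ (k + 1))) := by
  induction k with
  | zero =>
    refine ⟨fun t => 4 / R * mom 0 R t, fun t ht => ?_, ?_, ?_⟩
    · refine ((hasDerivAt_mom 0 R ht).const_mul (4 / R)).congr_deriv ?_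
      simp; field_simp
    · simpa using (tendsto_mom_zero 0 hR).const_mul (4 / R)
    · simpa using (tendsto_mom_zero_atTop R).const_mul (4 / R)
  | succ k ih =>
    obtain ⟨A, hA, h0, h1⟩ := ih
    refine ⟨fun t => 4 / R * (mom (k + 1) R t + (k + 1) * A t), fun t ht => ?_, ?_, ?_⟩
    · refine (((hasDerivAt_mom (k + 1) R ht).add ((hA t ht).const_mul _)).const_mul
        (4 / R)).congr_deriv ?_
      push_cast
      field_simp
      ring_nf
    · simpa using ((tendsto_mom_zero (k + 1) hR).add (h0.const_mul ((k : ℝ) + 1))).const_mul (4 / R)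
    · have := ((tendsto_mom_atTop k hR.le).add (h1.const_mul ((k : ℝ) + 1))).const_mul (4 / R)
      convert this using 2
      rw [Nat.factorial_succ]; push_cast; ring

lemma integrableOn_mom (k : ℕ) {R : ℝ} (hR : 0 < R) : IntegrableOn (mom (k + 2) R) (Ioi 0) := by
  obtain ⟨A, hA, h0, h1⟩ := exists_primitive_mom k hR
  exact (integral_Ioi_of_primitive hA (fun t ht => mom_nonneg _ R ht) h0 h1).1

lemma integral_mom (k : ℕ) {R : ℝ} (hR : 0 < R) :
    ∫ t in Ioi (0 : ℝ), mom (k + 2) R t = k.factorial * (4 / R) ^ (k + 1) := by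
  obtain ⟨A, hA, h0, h1⟩ := exists_primitive_mom k hR
  simpa using (integral_Ioi_of_primitive hA (fun t ht => mom_nonneg _ R ht) h0 h1).2

lemma integral_inv_pow_Ioi (k : ℕ) {t : ℝ} (ht : 0 < t) :
    IntegrableOn (fun s : ℝ => (s⁻¹) ^ (k + 2)) (Ioi t) ∧
      ∫ s in Ioi t, (s⁻¹) ^ (k + 2) = (t⁻¹) ^ (k + 1) / (k + 1) := by
  have hd : ∀ s ∈ Ici t, HasDerivAt (fun s : ℝ => -((s⁻¹) ^ (k + 1) / (k + 1)))
      ((s⁻¹) ^ (k + 2)) s := by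
    intro s hs
    have hs0 : s ≠ 0 := (lt_of_lt_of_le ht hs).ne'
    refine ((((hasDerivAt_inv hs0).fun_pow (k + 1)).div_const ((k : ℝ) + 1)).fun_neg).congr_deriv ?_
    have : (k : ℝ) + 1 ≠ 0 := by positivity
    simp only [Nat.add_sub_cancel]
    push_cast
    rw [show (s ^ 2)⁻¹ = s⁻¹ ^ 2 by rw [inv_pow], eq_comm, pow_add]
    field_simp
  have hl : Tendsto (fun s : ℝ => -((s⁻¹) ^ (k + 1) / (k + 1))) atTop (𝓝 0) := by
    simpa using (((tendsto_inv_atTop_zero (𝕜 := ℝ)).pow (k + 1)).div_const ((k : ℝ) + 1)).neg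
  have hn : ∀ s ∈ Ioi t, 0 ≤ (s⁻¹) ^ (k + 2) := fun s hs => by
    have : 0 < s := lt_trans ht hs
    positivity
  refine ⟨integrableOn_Ioi_deriv_of_nonneg' hd hn hl, ?_⟩
  rw [integral_Ioi_of_hasDerivAt_of_nonneg' hd hn hl]; simp

lemma aestronglyMeasurable_mom (k : ℕ) (R : ℝ) {s : Set ℝ} :
    AEStronglyMeasurable (mom k R) (volume.restrict s) := by
  have : Measurable (mom k R) := by unfold mom; fun_prop
  exact this.aestronglyMeasurable

lemma integrableOn_mom_Ioi (k : ℕ) {R t : ℝ} (hR : 0 ≤ R) (ht : 0 < t) :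
    IntegrableOn (mom (k + 2) R) (Ioi t) := by
  refine (integral_inv_pow_Ioi k ht).1.mono' (aestronglyMeasurable_mom _ _) ?_
  filter_upwards [ae_restrict_mem measurableSet_Ioi] with s hs
  have hs0 : 0 < s := lt_trans ht hs
  rw [Real.norm_of_nonneg (mom_nonneg _ _ hs0)]
  exact mom_le_inv _ hR hs0

lemma tail_nonneg (k : ℕ) (R : ℝ) {t : ℝ} (ht : 0 ≤ t) : 0 ≤ tail k R t :=
  setIntegral_nonneg measurableSet_Ioi fun _ hs => mom_nonneg _ _ (lt_of_le_of_lt ht hs)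

lemma tail_anti (k : ℕ) {R S t : ℝ} (hR : 0 ≤ R) (h : R ≤ S) (ht : 0 < t) :
    tail (k + 2) S t ≤ tail (k + 2) R t :=
  setIntegral_mono_on (integrableOn_mom_Ioi k (hR.trans h) ht) (integrableOn_mom_Ioi k hR ht)
    measurableSet_Ioi fun _ hs => mom_anti _ h (lt_trans ht hs)

lemma tail_le_inv (k : ℕ) {R t : ℝ} (hR : 0 ≤ R) (ht : 0 < t) :
    tail (k + 2) R t ≤ (t⁻¹) ^ (k + 1) := by
  have h := setIntegral_mono_on (integrableOn_mom_Ioi k hR ht) (integral_inv_pow_Ioi k ht).1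
    measurableSet_Ioi fun s hs => mom_le_inv _ hR (lt_trans ht hs)
  rw [(integral_inv_pow_Ioi k ht).2] at h
  exact h.trans (div_le_self (by positivity) (by linarith [(Nat.cast_nonneg k : (0:ℝ) ≤ k)]))

lemma tail_zero (k : ℕ) {R : ℝ} (hR : 0 < R) :
    tail (k + 2) R 0 = k.factorial * (4 / R) ^ (k + 1) := integral_mom k hR

lemma tail_le (k : ℕ) {R t : ℝ} (hR : 0 < R) (ht : 0 < t) :
    tail (k + 2) R t ≤ k.factorial * (4 / R) ^ (k + 1) := by
  rw [← tail_zero k hR]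
  refine setIntegral_mono_set (integrableOn_mom k hR) ?_ (Ioi_subset_Ioi ht.le).eventuallyLE
  filter_upwards [ae_restrict_mem measurableSet_Ioi] with s hs using mom_nonneg _ _ hs

lemma hasDerivAt_tail (k : ℕ) {R t : ℝ} (hR : 0 ≤ R) (ht : 0 < t) :
    HasDerivAt (tail (k + 2) R) (-mom (k + 2) R t) t := by
  have ht2 : 0 < t / 2 := by positivity
  have hint := integrableOn_mom_Ioi k hR ht2
  have hd : HasDerivAt (fun u => tail (k + 2) R (t / 2) - ∫ s in (t / 2)..u, mom (k + 2) R s)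
      (-mom (k + 2) R t) t := by
    refine HasDerivAt.const_sub _ (intervalIntegral.integral_hasDerivAt_right ?_ ?_ ?_)
    · rw [intervalIntegrable_iff_integrableOn_Ioc_of_le (by linarith)]
      exact hint.mono_set Ioc_subset_Ioi_self
    · exact (continuousOn_mom _ _).stronglyMeasurableAtFilter isOpen_Ioi t ht
    · exact (hasDerivAt_mom _ _ ht).continuousAt
  refine hd.congr_of_eventuallyEq ?_
  filter_upwards [Ioi_mem_nhds (show t / 2 < t by linarith)] with u hu
  have hu' : t / 2 < u := hu
  rw [eq_sub_iff_add_eq, add_comm, tail, tail, intervalIntegral.integral_of_le hu'.le,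
    ← setIntegral_union (Ioc_disjoint_Ioi le_rfl) measurableSet_Ioi
      (hint.mono_set Ioc_subset_Ioi_self) (hint.mono_set (Ioi_subset_Ioi hu'.le)),
    Ioc_union_Ioi_eq_Ioi hu'.le]

lemma continuousOn_tail (k : ℕ) {R : ℝ} (hR : 0 ≤ R) : ContinuousOn (tail (k + 2) R) (Ioi 0) :=
  fun _ ht => (hasDerivAt_tail k hR ht).continuousAt.continuousWithinAt

lemma tendsto_tail_atTop (k : ℕ) {R : ℝ} (hR : 0 ≤ R) :
    Tendsto (tail (k + 2) R) atTop (𝓝 0) := by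
  have h : Tendsto (fun t : ℝ => (t⁻¹) ^ (k + 1)) atTop (𝓝 0) := by
    simpa using (tendsto_inv_atTop_zero (𝕜 := ℝ)).pow (k + 1)
  refine squeeze_zero' ?_ ?_ h
  · filter_upwards [eventually_gt_atTop 0] with t ht using tail_nonneg _ R ht.le
  · filter_upwards [eventually_gt_atTop 0] with t ht using tail_le_inv _ hR ht

lemma tendsto_tail_zero (k : ℕ) {R : ℝ} (hR : 0 < R) :
    Tendsto (tail (k + 2) R) (𝓝[>] 0) (𝓝 (k.factorial * (4 / R) ^ (k + 1))) := by
  obtain ⟨A, hA, h0, h1⟩ := exists_primitive_mom k hR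
  have h2 := h0.const_sub (k.factorial * (4 / R) ^ (k + 1))
  rw [sub_zero] at h2
  refine h2.congr' ?_
  filter_upwards [self_mem_nhdsWithin] with t ht
  exact (integral_Ioi_of_hasDerivAt_of_nonneg' (fun s hs => hA s (lt_of_lt_of_le ht hs))
    (fun s hs => mom_nonneg _ _ (lt_trans ht hs)) h1).symm

/-- By Fubini the integral would be ∫ s · s^{-(k+3)} e^{-R/4s} ds, the moment of order k + 2. The
explicit primitive t · `tail (k + 3)` - `tail (k + 2)` gives this without a double integral. -/
lemma integrableOn_integral_tail (k : ℕ) {R : ℝ} (hR : 0 < R) :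
    IntegrableOn (tail (k + 3) R) (Ioi 0) ∧
      ∫ t in Ioi (0 : ℝ), tail (k + 3) R t = k.factorial * (4 / R) ^ (k + 1) := by
  have hd : ∀ t, 0 < t → HasDerivAt (fun t => t * tail (k + 3) R t - tail (k + 2) R t)
      (tail (k + 3) R t) t := by
    intro t ht
    refine (((hasDerivAt_id t).mul (hasDerivAt_tail (k + 1) hR.le ht)).sub
      (hasDerivAt_tail k hR.le ht)).congr_deriv ?_
    rw [mom_succ (k + 2) R ht]; simp
  have hz : Tendsto (fun t : ℝ => t) (𝓝[>] 0) (𝓝 0) := nhdsWithin_le_nhds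
  have h0 := (hz.mul (tendsto_tail_zero (k + 1) hR)).sub (tendsto_tail_zero k hR)
  have h1 : Tendsto (fun t => t * tail (k + 3) R t - tail (k + 2) R t) atTop (𝓝 (0 - 0)) := by
    refine Tendsto.sub ?_ (tendsto_tail_atTop k hR.le)
    have h : Tendsto (fun t : ℝ => (t⁻¹) ^ (k + 1)) atTop (𝓝 0) := by
      simpa using (tendsto_inv_atTop_zero (𝕜 := ℝ)).pow (k + 1)
    refine squeeze_zero' ?_ ?_ h
    · filter_upwards [eventually_gt_atTop 0] with t ht using
        mul_nonneg ht.le (tail_nonneg _ R ht.le)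
    · filter_upwards [eventually_gt_atTop 0] with t ht
      calc _ ≤ t * (t⁻¹) ^ (k + 2) := mul_le_mul_of_nonneg_left (tail_le_inv (k + 1) hR.le ht) ht.le
        _ = _ := by rw [pow_succ]; field_simp
  have := integral_Ioi_of_primitive hd (fun t ht => tail_nonneg _ _ ht.le) h0 h1
  simpa using this

/-- Integration by parts relating the kernel and its tails. -/
lemma mom_one_eq {R t : ℝ} (hR : 0 ≤ R) (ht : 0 < t) :
    mom 1 R t = tail 2 R t - R / 4 * tail 3 R t := by
  have hi2 := integrableOn_mom_Ioi 0 hR ht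
  have hi3 := integrableOn_mom_Ioi 1 hR ht
  have h := integral_Ioi_of_hasDerivAt_of_tendsto'
    (fun s hs => hasDerivAt_mom 1 R (lt_of_lt_of_le ht hs))
    ((hi3.const_mul (R / 4)).sub (hi2.const_mul _)) (tendsto_mom_atTop 0 hR)
  rw [integral_sub (hi3.const_mul (R / 4)) (hi2.const_mul _), integral_const_mul,
    integral_const_mul] at h
  simp only [tail]
  norm_num at h ⊢
  linarith

/-! ### Oscillatory integrals -/

lemma intervalIntegrable_of_norm_le {E : Type*} [NormedAddCommGroup E] {h : ℝ → E} {M T : ℝ}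
    (hc : ContinuousOn h (Ioi 0)) (hT : 0 ≤ T) (hM : ∀ t ∈ Ioc 0 T, ‖h t‖ ≤ M) :
    IntervalIntegrable h volume 0 T := by
  rw [intervalIntegrable_iff_integrableOn_Ioc_of_le hT]
  refine IntegrableOn.of_bound (by simp) ?_ M ?_
  · exact (hc.mono Ioc_subset_Ioi_self).aestronglyMeasurable measurableSet_Ioc
  · filter_upwards [ae_restrict_mem measurableSet_Ioc] with t ht using hM t ht

/-- The unit complex number of argument `θ`. -/
noncomputable def cis (θ : ℝ) : ℂ := Complex.exp (θ * Complex.I)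

@[simp] lemma norm_cis (θ : ℝ) : ‖cis θ‖ = 1 := Complex.norm_exp_ofReal_mul_I θ

lemma cis_add (θ φ : ℝ) : cis (θ + φ) = cis θ * cis φ := by
  simp only [cis, ← Complex.exp_add]; push_cast; ring_nf

@[simp] lemma cis_zero : cis 0 = 1 := by simp [cis]

lemma continuous_cis : Continuous cis := by unfold cis; fun_prop

lemma hasDerivAt_cis (ν t : ℝ) :
    HasDerivAt (fun t : ℝ => cis (ν * t)) (ν * Complex.I * cis (ν * t)) t := by
  have h : HasDerivAt (fun t : ℝ => (((ν * t : ℝ) : ℂ)) * Complex.I) (ν * Complex.I) t := by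
    have := (((hasDerivAt_id t).const_mul ν).ofReal_comp).mul_const Complex.I
    simpa using this
  simpa [cis, mul_comm] using h.cexp

/-- The primitive of `cis (ν t)` vanishing at the origin. -/
noncomputable def cisPrim (ν t : ℝ) : ℂ := (cis (ν * t) - 1) / (ν * Complex.I)

lemma norm_cisPrim_le (ν t : ℝ) : ‖cisPrim ν t‖ ≤ 2 / |ν| := by
  rw [cisPrim, norm_div]
  simp only [norm_mul, Complex.norm_real, Complex.norm_I, mul_one, Real.norm_eq_abs]
  gcongr
  calc _ ≤ ‖cis (ν * t)‖ + ‖(1 : ℂ)‖ := norm_sub_le _ _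
    _ = 2 := by norm_num

lemma hasDerivAt_cisPrim {ν : ℝ} (hν : ν ≠ 0) (t : ℝ) :
    HasDerivAt (cisPrim ν) (cis (ν * t)) t := by
  have hν' : (ν : ℂ) * Complex.I ≠ 0 := by simp [hν]
  refine (((hasDerivAt_cis ν t).sub_const 1).div_const ((ν : ℂ) * Complex.I)).congr_deriv ?_
  exact mul_div_cancel_left₀ _ hν'

lemma continuous_cisPrim (ν : ℝ) : Continuous (cisPrim ν) := by
  have := continuous_cis
  unfold cisPrim; fun_prop

section Oscillation

variable {ν : ℝ} {g g' : ℝ → ℝ} {M N T : ℝ}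

lemma intervalIntegrable_cis_mul (hc : ContinuousOn g (Ioi 0)) (hb : ∀ t, 0 < t → |g t| ≤ M)
    (hT : 0 ≤ T) : IntervalIntegrable (fun t => cis (ν * t) * (g t : ℂ)) volume 0 T := by
  refine intervalIntegrable_of_norm_le (M := M) ?_ hT fun t ht => ?_
  · have := continuous_cis
    exact (Continuous.continuousOn (by fun_prop)).mul
      (Complex.continuous_ofReal.comp_continuousOn hc)
  · simpa using hb t ht.1

lemma integrableOn_cisPrim_mul (hg' : IntegrableOn g' (Ioi 0)) :
    IntegrableOn (fun t => cisPrim ν t * (g' t : ℂ)) (Ioi 0) := by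
  refine Integrable.bdd_mul (c := 2 / |ν|) hg'.ofReal
    (continuous_cisPrim ν).aestronglyMeasurable ?_
  filter_upwards with t using norm_cisPrim_le ν t

/-- Integration by parts. Since `cisPrim` vanishes at the origin, the boundary term at 0 disappears
as soon as `g` is bounded; no limit of `g` at 0 is needed. -/
lemma integral_cis_mul (hν : ν ≠ 0) (hd : ∀ t, 0 < t → HasDerivAt g (g' t) t)
    (hb : ∀ t, 0 < t → |g t| ≤ M) (hg' : IntegrableOn g' (Ioi 0)) (hT : 0 < T) :
    ∫ t in (0 : ℝ)..T, cis (ν * t) * (g t : ℂ) =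
      cisPrim ν T * g T - ∫ t in (0 : ℝ)..T, cisPrim ν t * (g' t : ℂ) := by
  have hc : ContinuousOn g (Ioi 0) := fun t ht => (hd t ht).continuousAt.continuousWithinAt
  have hD : ∀ t, 0 < t → HasDerivAt (fun t => cisPrim ν t * (g t : ℂ))
      (cis (ν * t) * (g t : ℂ) + cisPrim ν t * (g' t : ℂ)) t := fun t ht =>
    (hasDerivAt_cisPrim hν t).mul (hd t ht).ofReal_comp
  have hi1 := intervalIntegrable_cis_mul (ν := ν) hc hb hT.le
  have hi2 : IntervalIntegrable (fun t => cisPrim ν t * (g' t : ℂ)) volume 0 T := by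
    rw [intervalIntegrable_iff_integrableOn_Ioc_of_le hT.le]
    exact (integrableOn_cisPrim_mul hg').mono_set Ioc_subset_Ioi_self
  have h0 : Tendsto (fun t => cisPrim ν t * (g t : ℂ)) (𝓝[>] 0) (𝓝 0) := by
    have h : Tendsto (fun t => ‖cisPrim ν t‖ * M) (𝓝[>] 0) (𝓝 0) := by
      have : Continuous fun t => ‖cisPrim ν t‖ * M := (continuous_cisPrim ν).norm.mul_const M
      simpa [cisPrim] using (this.tendsto 0).mono_left nhdsWithin_le_nhds
    refine squeeze_zero_norm' ?_ h
    filter_upwards [self_mem_nhdsWithin] with t ht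
    rw [norm_mul, Complex.norm_real]
    exact mul_le_mul_of_nonneg_left (hb t ht) (norm_nonneg _)
  have hT' : Tendsto (fun t => cisPrim ν t * (g t : ℂ)) (𝓝[<] T) (𝓝 (cisPrim ν T * (g T : ℂ))) :=
    (hD T hT).continuousAt.tendsto.mono_left nhdsWithin_le_nhds
  have := intervalIntegral.integral_eq_sub_of_hasDerivAt_of_tendsto hT
    (fun t ht => hD t ht.1) (hi1.add hi2) h0 hT'
  rw [intervalIntegral.integral_add hi1 hi2] at this
  rw [eq_sub_iff_add_eq, this, sub_zero]

/-- Source of every factor |a|⁻¹: the primitive of the phase is at most 2/|ν|, and it multiplies the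
supremum and the total variation of `g`. The bound does not depend on T. -/
lemma norm_integral_cis_mul_le (hν : ν ≠ 0) (hd : ∀ t, 0 < t → HasDerivAt g (g' t) t)
    (hb : ∀ t, 0 < t → |g t| ≤ M) (hg' : IntegrableOn g' (Ioi 0))
    (hN : ∫ t in Ioi (0 : ℝ), |g' t| ≤ N) (hT : 0 < T) :
    ‖∫ t in (0 : ℝ)..T, cis (ν * t) * (g t : ℂ)‖ ≤ 2 * (M + N) / |ν| := by
  rw [integral_cis_mul hν hd hb hg' hT]
  have h1 : ‖cisPrim ν T * (g T : ℂ)‖ ≤ 2 / |ν| * M := by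
    rw [norm_mul, Complex.norm_real]
    exact mul_le_mul (norm_cisPrim_le ν T) (hb T hT) (norm_nonneg _) (by positivity)
  have hi : IntegrableOn (fun t => 2 / |ν| * |g' t|) (Ioi 0) := hg'.abs.const_mul _
  have h2 : ‖∫ t in (0 : ℝ)..T, cisPrim ν t * (g' t : ℂ)‖ ≤ 2 / |ν| * N := by
    refine (intervalIntegral.norm_integral_le_of_norm_le (g := fun t => 2 / |ν| * |g' t|) hT.le
      ?_ ?_).trans ?_
    · filter_upwards with t _
      rw [norm_mul, Complex.norm_real]
      exact mul_le_mul_of_nonneg_right (norm_cisPrim_le ν t) (norm_nonneg _)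
    · rw [intervalIntegrable_iff_integrableOn_Ioc_of_le hT.le]
      exact hi.mono_set Ioc_subset_Ioi_self
    · rw [intervalIntegral.integral_const_mul, intervalIntegral.integral_of_le hT.le]
      gcongr
      refine (setIntegral_mono_set hg'.abs ?_ Ioc_subset_Ioi_self.eventuallyLE).trans hN
      filter_upwards with t using abs_nonneg _
  calc _ ≤ 2 / |ν| * M + 2 / |ν| * N := (norm_sub_le _ _).trans (add_le_add h1 h2)
    _ = _ := by ring

lemma tendsto_integral_cis_mul (hν : ν ≠ 0) (hd : ∀ t, 0 < t → HasDerivAt g (g' t) t)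
    (hb : ∀ t, 0 < t → |g t| ≤ M) (hg' : IntegrableOn g' (Ioi 0)) (h0 : Tendsto g atTop (𝓝 0)) :
    ∃ L : ℂ, Tendsto (fun T => ∫ t in (0 : ℝ)..T, cis (ν * t) * (g t : ℂ)) atTop (𝓝 L) := by
  have h1 : Tendsto (fun T => cisPrim ν T * (g T : ℂ)) atTop (𝓝 0) := by
    have h : Tendsto (fun T => 2 / |ν| * |g T|) atTop (𝓝 0) := by
      simpa using h0.abs.const_mul (2 / |ν|)
    refine squeeze_zero_norm (fun t => ?_) h
    rw [norm_mul, Complex.norm_real]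
    exact mul_le_mul_of_nonneg_right (norm_cisPrim_le ν t) (norm_nonneg _)
  refine ⟨_, (h1.sub (intervalIntegral_tendsto_integral_Ioi 0
    (integrableOn_cisPrim_mul (ν := ν) hg') tendsto_id)).congr' ?_⟩
  filter_upwards [eventually_gt_atTop 0] with T hT
  exact (integral_cis_mul hν hd hb hg' hT).symm

end Oscillation

/-! ### Taylor expansion of moments and tails in the squared radius -/

lemma abs_exp_sub_one_le_mul_exp (v : ℝ) : |Real.exp v - 1| ≤ |v| * Real.exp |v| := by
  have h := Complex.norm_exp_sub_sum_le_norm_mul_exp (v : ℂ) 1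
  simp only [Finset.sum_range_one, pow_zero, Nat.factorial_zero, Nat.cast_one, div_one, pow_one,
    Complex.norm_real, Real.norm_eq_abs] at h
  rw [← Complex.ofReal_exp, ← Complex.ofReal_one, ← Complex.ofReal_sub, Complex.norm_real] at h
  exact h

lemma abs_exp_sub_one_sub_le_mul_exp (v : ℝ) :
    |Real.exp v - 1 - v| ≤ v ^ 2 * Real.exp |v| := by
  have h := Complex.norm_exp_sub_sum_le_norm_mul_exp (v : ℂ) 2
  simp only [Finset.sum_range_succ, Finset.sum_range_zero, pow_zero, Nat.factorial_zero,
    Nat.cast_one, div_one, pow_one, Nat.factorial_one, zero_add,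
    Complex.norm_real, Real.norm_eq_abs, sq_abs] at h
  rw [← Complex.ofReal_exp, ← Complex.ofReal_one, ← Complex.ofReal_add, ← Complex.ofReal_sub,
    Complex.norm_real, ← sub_sub] at h
  exact h

lemma mom_sub (k : ℕ) (R d t : ℝ) :
    mom k (R - d) t = mom k R t * Real.exp (d * t⁻¹ / 4) := by
  rw [mom, mom, mul_assoc, ← Real.exp_add]; ring_nf

/-- The factor e^{|v|} in the Taylor remainders is absorbed by lowering the radius parameter from R
to m. -/
lemma mom_mul_exp_le (k : ℕ) {R d m t : ℝ} (hm : m ≤ R - |d|) (ht : 0 < t) :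
    mom k R t * Real.exp |d * t⁻¹ / 4| ≤ mom k m t := by
  have : |d * t⁻¹ / 4| = |d| * t⁻¹ / 4 := by
    rw [abs_div, abs_mul, abs_of_pos (inv_pos.2 ht), abs_of_pos (by norm_num : (0 : ℝ) < 4)]
  rw [this, ← mom_sub]
  exact mom_anti k hm ht

lemma mom_taylor_one (k : ℕ) {R d m t : ℝ} (hm : m ≤ R - |d|) (ht : 0 < t) :
    |mom k (R - d) t - mom k R t| ≤ |d| / 4 * mom (k + 1) m t := by
  have h := abs_exp_sub_one_le_mul_exp (d * t⁻¹ / 4)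
  have e : mom k (R - d) t - mom k R t = mom k R t * (Real.exp (d * t⁻¹ / 4) - 1) := by
    rw [mom_sub]; ring
  rw [e, abs_mul, abs_of_nonneg (mom_nonneg k R ht)]
  calc _ ≤ mom k R t * (|d * t⁻¹ / 4| * Real.exp |d * t⁻¹ / 4|) :=
        mul_le_mul_of_nonneg_left h (mom_nonneg k R ht)
    _ = |d * t⁻¹ / 4| * (mom k R t * Real.exp |d * t⁻¹ / 4|) := by ring
    _ ≤ |d * t⁻¹ / 4| * mom k m t :=
        mul_le_mul_of_nonneg_left (mom_mul_exp_le k hm ht) (abs_nonneg _)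
    _ = _ := by
        rw [abs_div, abs_mul, abs_of_pos (inv_pos.2 ht), abs_of_pos (by norm_num : (0 : ℝ) < 4),
          mom, mom, pow_succ]
        ring

lemma mom_taylor_two (k : ℕ) {R d m t : ℝ} (hm : m ≤ R - |d|) (ht : 0 < t) :
    |mom k (R - d) t - (mom k R t + d / 4 * mom (k + 1) R t)| ≤
      d ^ 2 / 16 * mom (k + 2) m t := by
  have h := abs_exp_sub_one_sub_le_mul_exp (d * t⁻¹ / 4)
  have e : mom k (R - d) t - (mom k R t + d / 4 * mom (k + 1) R t) =
      mom k R t * (Real.exp (d * t⁻¹ / 4) - 1 - d * t⁻¹ / 4) := by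
    rw [mom_sub, mom, mom, pow_succ]; ring
  rw [e, abs_mul, abs_of_nonneg (mom_nonneg k R ht)]
  calc _ ≤ mom k R t * ((d * t⁻¹ / 4) ^ 2 * Real.exp |d * t⁻¹ / 4|) :=
        mul_le_mul_of_nonneg_left h (mom_nonneg k R ht)
    _ = (d * t⁻¹ / 4) ^ 2 * (mom k R t * Real.exp |d * t⁻¹ / 4|) := by ring
    _ ≤ (d * t⁻¹ / 4) ^ 2 * mom k m t :=
        mul_le_mul_of_nonneg_left (mom_mul_exp_le k hm ht) (sq_nonneg _)
    _ = _ := by rw [mom, mom, pow_add]; ring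

lemma tail_taylor_one (k : ℕ) {R d m t : ℝ} (h0 : 0 ≤ m) (hm : m ≤ R - |d|) (ht : 0 < t) :
    |tail (k + 2) (R - d) t - tail (k + 2) R t| ≤ |d| / 4 * tail (k + 3) m t := by
  have hR : 0 ≤ R := by linarith [abs_nonneg d]
  have hRd : 0 ≤ R - d := by linarith [le_abs_self d]
  rw [tail, tail, tail, ← integral_sub (integrableOn_mom_Ioi k hRd ht)
    (integrableOn_mom_Ioi k hR ht), ← integral_const_mul]
  rw [← Real.norm_eq_abs (∫ s in Ioi t, _)]
  refine MeasureTheory.norm_integral_le_of_norm_le ((integrableOn_mom_Ioi (k + 1) h0 ht).const_mul _) ?_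
  filter_upwards [ae_restrict_mem measurableSet_Ioi] with s hs
  exact mom_taylor_one (k + 2) hm (lt_trans ht hs)

lemma tail_taylor_two (k : ℕ) {R d m t : ℝ} (h0 : 0 ≤ m) (hm : m ≤ R - |d|) (ht : 0 < t) :
    |tail (k + 2) (R - d) t - (tail (k + 2) R t + d / 4 * tail (k + 3) R t)| ≤
      d ^ 2 / 16 * tail (k + 4) m t := by
  have hR : 0 ≤ R := by linarith [abs_nonneg d]
  have hRd : 0 ≤ R - d := by linarith [le_abs_self d]
  have i1 := integrableOn_mom_Ioi k hR ht
  have i2 := (integrableOn_mom_Ioi (k + 1) hR ht).const_mul (d / 4)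
  rw [tail, tail, tail, tail, ← integral_const_mul, ← integral_add i1 i2,
    ← integral_const_mul, ← integral_sub (integrableOn_mom_Ioi k hRd ht) (by exact i1.add i2)]
  rw [← Real.norm_eq_abs (∫ s in Ioi t, _)]
  refine MeasureTheory.norm_integral_le_of_norm_le ((integrableOn_mom_Ioi (k + 2) h0 ht).const_mul _) ?_
  filter_upwards [ae_restrict_mem measurableSet_Ioi] with s hs
  exact mom_taylor_two (k + 2) hm (lt_trans ht hs)

lemma mom_lipschitz (k : ℕ) {R S t : ℝ} (hR : 0 ≤ R) (hS : 0 ≤ S) (ht : 0 < t) :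
    |mom k R t - mom k S t| ≤ |R - S| / 4 * (t⁻¹) ^ (k + 1) := by
  wlog h : R ≤ S generalizing R S
  · rw [abs_sub_comm, abs_sub_comm R S]
    exact this hS hR (le_of_not_ge h)
  -- With R ≤ S the expansion around S has R = S - d, so m = 0 is admissible and the remainder is a
  -- plain power of t⁻¹.
  have h1 := mom_taylor_one (R := S) (d := S - R) (m := 0) k
    (by rw [abs_of_nonneg (by linarith)]; linarith) ht
  rw [sub_sub_cancel, abs_sub_comm S R] at h1
  exact h1.trans (mul_le_mul_of_nonneg_left (mom_le_inv _ le_rfl ht) (by positivity))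

lemma tail_lipschitz (k : ℕ) {R S t : ℝ} (hR : 0 ≤ R) (hS : 0 ≤ S) (ht : 0 < t) :
    |tail (k + 2) R t - tail (k + 2) S t| ≤ |R - S| / 4 * (t⁻¹) ^ (k + 2) := by
  wlog h : R ≤ S generalizing R S
  · rw [abs_sub_comm, abs_sub_comm R S]
    exact this hS hR (le_of_not_ge h)
  have h1 := tail_taylor_one (R := S) (d := S - R) (m := 0) k le_rfl
    (by rw [abs_of_nonneg (by linarith)]; linarith) ht
  rw [sub_sub_cancel, abs_sub_comm S R] at h1
  exact h1.trans (mul_le_mul_of_nonneg_left (tail_le_inv (k + 1) le_rfl ht) (by positivity))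

/-- The Lipschitz bound in the radius handles the variation of `r`, and continuity in time at frozen
radius handles the rest. -/
lemma continuousOn_tail_comp (k : ℕ) {r : ℝ → ℝ} (hr : Continuous r) (h0 : ∀ t, 0 ≤ r t) :
    ContinuousOn (fun t => tail (k + 2) (r t) t) (Ioi 0) := by
  intro t ht
  refine ContinuousAt.continuousWithinAt ?_
  have h1 : Tendsto (fun s => tail (k + 2) (r t) s) (𝓝 t) (𝓝 (tail (k + 2) (r t) t)) :=
    (hasDerivAt_tail k (h0 t) ht).continuousAt
  have h2 : Tendsto (fun s => tail (k + 2) (r s) s - tail (k + 2) (r t) s) (𝓝 t) (𝓝 0) := by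
    have h3 : Tendsto (fun s => |r s - r t| / 4 * (s⁻¹) ^ (k + 2)) (𝓝 t)
        (𝓝 (|r t - r t| / 4 * (t⁻¹) ^ (k + 2))) := by
      refine Tendsto.mul ?_ ((tendsto_inv₀ (ne_of_gt ht)).pow _)
      exact ((by fun_prop : Continuous fun s => |r s - r t| / 4).tendsto t)
    simp only [sub_self, abs_zero, zero_div, zero_mul] at h3
    refine squeeze_zero_norm' ?_ h3
    filter_upwards [Ioi_mem_nhds ht] with s hs using tail_lipschitz k (h0 s) (h0 t) hs
  have h4 := h2.add h1
  rw [zero_add] at h4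
  exact h4.congr fun s => by ring

lemma continuousOn_mom_comp (k : ℕ) {r : ℝ → ℝ} (hr : Continuous r) :
    ContinuousOn (fun t => mom k (r t) t) (Ioi 0) := by
  have hi : ContinuousOn (fun t : ℝ => t⁻¹) (Ioi 0) :=
    continuousOn_inv₀.mono fun t ht => ne_of_gt ht
  unfold mom
  exact (hi.pow k).mul ((((hr.continuousOn.mul hi).div_const 4).neg).rexp)

lemma integrableOn_Ioi_of_decay {h : ℝ → ℂ} {C : ℝ} (hc : ContinuousOn h (Ioi 0))
    (h1 : IntervalIntegrable h volume 0 1) (hC : ∀ t, 1 < t → ‖h t‖ ≤ C * (t⁻¹) ^ 2) :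
    IntegrableOn h (Ioi 0) := by
  rw [← Ioc_union_Ioi_eq_Ioi (zero_le_one' ℝ)]
  refine IntegrableOn.union ((intervalIntegrable_iff_integrableOn_Ioc_of_le zero_le_one).1 h1) ?_
  refine ((integral_inv_pow_Ioi 0 one_pos).1.const_mul C).mono' ?_ ?_
  · exact (hc.mono (Ioi_subset_Ioi zero_le_one)).aestronglyMeasurable measurableSet_Ioi
  · filter_upwards [ae_restrict_mem measurableSet_Ioi] with t ht using hC t ht

/-! ### The two complex coefficients of the integrand and their convergence -/

section Coefficients

variable (a : ℝ) (x y : ℂ)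

/-- The rotated difference `O(at)x - y` in complex notation. -/
noncomputable def rotDiff (t : ℝ) : ℂ := cis (a * t) * x - y

/-- The complex-linear part of the integrand, up to the factor `1 / (8π)`. -/
noncomputable def linPart (t : ℝ) : ℂ := cis (-a * t) * (mom 1 (‖rotDiff a x y t‖ ^ 2) t : ℂ)

/-- The antilinear part of the integrand, up to the factor `1 / (32π)`. -/
noncomputable def antiPart (t : ℝ) : ℂ :=
  cis (-a * t) * rotDiff a x y t ^ 2 * (tail 3 (‖rotDiff a x y t‖ ^ 2) t : ℂ)

lemma continuous_rotDiff : Continuous (rotDiff a x y) := by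
  have := continuous_cis
  unfold rotDiff; fun_prop

lemma continuousOn_linPart : ContinuousOn (linPart a x y) (Ioi 0) := by
  have h1 := continuous_cis
  have h2 := continuous_rotDiff a x y
  exact (Continuous.continuousOn (by fun_prop)).mul
    (Complex.continuous_ofReal.comp_continuousOn (continuousOn_mom_comp 1 (by fun_prop)))

lemma continuousOn_antiPart : ContinuousOn (antiPart a x y) (Ioi 0) := by
  have h1 := continuous_cis
  have h2 := continuous_rotDiff a x y
  exact (Continuous.continuousOn (by fun_prop)).mul
    (Complex.continuous_ofReal.comp_continuousOn
      (continuousOn_tail_comp 1 (by fun_prop) fun t => by positivity))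

lemma norm_rotDiff_le (t : ℝ) : ‖rotDiff a x y t‖ ≤ ‖x‖ + ‖y‖ := by
  refine (norm_sub_le _ _).trans ?_
  simp

lemma norm_linPart {t : ℝ} (ht : 0 < t) : ‖linPart a x y t‖ = mom 1 (‖rotDiff a x y t‖ ^ 2) t := by
  rw [linPart, norm_mul, norm_cis, Complex.norm_real, one_mul,
    Real.norm_of_nonneg (mom_nonneg _ _ ht)]

lemma norm_antiPart_le {t : ℝ} (ht : 0 < t) :
    ‖antiPart a x y t‖ ≤ (‖x‖ + ‖y‖) ^ 2 * tail 3 (‖rotDiff a x y t‖ ^ 2) t := by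
  rw [antiPart, norm_mul, norm_mul, norm_cis, Complex.norm_real, one_mul, norm_pow,
    Real.norm_of_nonneg (tail_nonneg _ _ ht.le)]
  have := norm_rotDiff_le a x y t
  have := tail_nonneg 3 (‖rotDiff a x y t‖ ^ 2) ht.le
  gcongr

variable {x y}

/-- Only times near 0 matter: O(at)x may meet y later if |x| = |y|, but there the powers of t⁻¹ are
already bounded. -/
lemma exists_le_norm_rotDiff (hxy : x ≠ y) :
    ∃ t₀ > 0, ∃ m > 0, ∀ t, 0 < t → t < t₀ → m ≤ ‖rotDiff a x y t‖ ^ 2 := by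
  have hp : 0 < ‖x - y‖ ^ 2 := by
    have := norm_pos_iff.2 (sub_ne_zero.2 hxy)
    positivity
  have hc : Continuous fun t => ‖rotDiff a x y t‖ ^ 2 := (continuous_rotDiff a x y).norm.pow 2
  have h0 : ‖x - y‖ ^ 2 / 2 < ‖rotDiff a x y 0‖ ^ 2 := by simp [rotDiff]; linarith
  obtain ⟨ε, hε, h⟩ := Metric.eventually_nhds_iff.1 ((hc.tendsto 0).eventually_const_lt h0)
  refine ⟨ε, hε, _, half_pos hp, fun t ht hte => (h ?_).le⟩
  simpa [abs_of_pos ht] using hte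

lemma intervalIntegrable_linPart (hxy : x ≠ y) {T : ℝ} (hT : 0 ≤ T) :
    IntervalIntegrable (linPart a x y) volume 0 T := by
  obtain ⟨t₀, ht₀, m, hm, h⟩ := exists_le_norm_rotDiff a hxy
  refine intervalIntegrable_of_norm_le (M := max (Nat.factorial 1 * (4 / m) ^ 1) (t₀⁻¹ ^ 1))
    (continuousOn_linPart a x y) hT fun t ht => ?_
  rw [norm_linPart a x y ht.1]
  rcases lt_or_ge t t₀ with h1 | h1
  · exact ((mom_anti 1 (h t ht.1 h1) ht.1).trans (mom_le 1 hm ht.1)).trans (le_max_left _ _)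
  · refine ((mom_le_inv 1 (by positivity) ht.1).trans ?_).trans (le_max_right _ _)
    have := ht.1
    gcongr

lemma intervalIntegrable_antiPart (hxy : x ≠ y) {T : ℝ} (hT : 0 ≤ T) :
    IntervalIntegrable (antiPart a x y) volume 0 T := by
  obtain ⟨t₀, ht₀, m, hm, h⟩ := exists_le_norm_rotDiff a hxy
  refine intervalIntegrable_of_norm_le
    (M := (‖x‖ + ‖y‖) ^ 2 * max (Nat.factorial 1 * (4 / m) ^ 2) (t₀⁻¹ ^ 2))
    (continuousOn_antiPart a x y) hT fun t ht => ?_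
  refine (norm_antiPart_le a x y ht.1).trans (mul_le_mul_of_nonneg_left ?_ (by positivity))
  rcases lt_or_ge t t₀ with h1 | h1
  · exact ((tail_anti 1 hm.le (h t ht.1 h1) ht.1).trans (tail_le 1 hm ht.1)).trans (le_max_left _ _)
  · refine ((tail_le_inv 1 (by positivity) ht.1).trans ?_).trans (le_max_right _ _)
    have := ht.1
    gcongr

lemma tendsto_integral_antiPart (hxy : x ≠ y) :
    ∃ L : ℂ, Tendsto (fun T => ∫ t in (0 : ℝ)..T, antiPart a x y t) atTop (𝓝 L) := by
  refine ⟨_, intervalIntegral_tendsto_integral_Ioi 0 ?_ tendsto_id⟩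
  refine integrableOn_Ioi_of_decay (C := (‖x‖ + ‖y‖) ^ 2) (continuousOn_antiPart a x y)
    (intervalIntegrable_antiPart a hxy zero_le_one) fun t ht => ?_
  have ht0 : 0 < t := by linarith
  exact (norm_antiPart_le a x y ht0).trans
    (mul_le_mul_of_nonneg_left (tail_le_inv 1 (by positivity) ht0) (by positivity))

/-- Both terms of the derivative of `mom (k + 1) R` have the same integral (k+1)! (4/R)^{k+1}, hence
the factor 2. -/
lemma hasDerivAt_mom_abs_le (k : ℕ) {R : ℝ} (hR : 0 < R) :
    IntegrableOn (fun t => R / 4 * mom (k + 3) R t - ((k + 1 : ℕ) : ℝ) * mom (k + 2) R t) (Ioi 0) ∧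
    ∫ t in Ioi (0 : ℝ), |R / 4 * mom (k + 3) R t - ((k + 1 : ℕ) : ℝ) * mom (k + 2) R t| ≤
      2 * ((k + 1).factorial * (4 / R) ^ (k + 1)) := by
  have i1 := (integrableOn_mom (k + 1) hR).const_mul (R / 4)
  have i2 := (integrableOn_mom k hR).const_mul ((k + 1 : ℕ) : ℝ)
  refine ⟨i1.sub i2, ?_⟩
  have h : ∫ t in Ioi (0 : ℝ), |R / 4 * mom (k + 3) R t - ((k + 1 : ℕ) : ℝ) * mom (k + 2) R t| ≤
      ∫ t in Ioi (0 : ℝ), (R / 4 * mom (k + 3) R t + ((k + 1 : ℕ) : ℝ) * mom (k + 2) R t) := by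
    refine setIntegral_mono_on (i1.sub i2).abs (i1.add i2) measurableSet_Ioi fun t ht => ?_
    refine (abs_sub _ _).trans (le_of_eq ?_)
    have ht' : 0 < t := ht
    rw [abs_of_nonneg (mul_nonneg (by positivity) (mom_nonneg _ _ ht')),
      abs_of_nonneg (mul_nonneg (by positivity) (mom_nonneg _ _ ht'))]
  refine h.trans (le_of_eq ?_)
  rw [integral_add i1 i2, integral_const_mul, integral_const_mul, integral_mom (k + 1) hR,
    integral_mom k hR, Nat.factorial_succ]
  push_cast
  have e : R / 4 * (4 / R) = 1 := by field_simp
  linear_combination ((k + 1) * k.factorial * (4 / R) ^ (k + 1)) * e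

lemma abs_mom_le (k : ℕ) {R : ℝ} (hR : 0 < R) (t : ℝ) (ht : 0 < t) :
    |mom k R t| ≤ k.factorial * (4 / R) ^ k := by
  rw [abs_of_nonneg (mom_nonneg _ _ ht)]; exact mom_le k hR ht

lemma abs_tail_le (k : ℕ) {R : ℝ} (hR : 0 < R) (t : ℝ) (ht : 0 < t) :
    |tail (k + 2) R t| ≤ k.factorial * (4 / R) ^ (k + 1) := by
  rw [abs_of_nonneg (tail_nonneg _ _ ht.le)]; exact tail_le k hR ht

lemma norm_integral_cis_mul_mom_le (k : ℕ) {R ν T : ℝ} (hR : 0 < R) (hν : ν ≠ 0) (hT : 0 < T) :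
    ‖∫ t in (0 : ℝ)..T, cis (ν * t) * (mom (k + 1) R t : ℂ)‖ ≤
      6 * ((k + 1).factorial * (4 / R) ^ (k + 1)) / |ν| := by
  have h := hasDerivAt_mom_abs_le k hR
  refine (norm_integral_cis_mul_le hν (fun t ht => hasDerivAt_mom (k + 1) R ht)
    (abs_mom_le _ hR) h.1 h.2 hT).trans (le_of_eq ?_)
  ring

lemma norm_integral_cis_mul_tail_le (k : ℕ) {R ν T : ℝ} (hR : 0 < R) (hν : ν ≠ 0) (hT : 0 < T) :
    ‖∫ t in (0 : ℝ)..T, cis (ν * t) * (tail (k + 2) R t : ℂ)‖ ≤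
      4 * (k.factorial * (4 / R) ^ (k + 1)) / |ν| := by
  have hN : ∫ t in Ioi (0 : ℝ), |-mom (k + 2) R t| ≤ k.factorial * (4 / R) ^ (k + 1) := by
    rw [← integral_mom k hR]
    refine le_of_eq (setIntegral_congr_fun measurableSet_Ioi fun t ht => ?_)
    simp only [abs_neg]
    exact abs_of_nonneg (mom_nonneg _ _ ht)
  refine (norm_integral_cis_mul_le hν (fun t ht => hasDerivAt_tail k hR.le ht)
    (abs_tail_le _ hR) (integrableOn_mom k hR).neg hN hT).trans (le_of_eq ?_)
  ring

variable {a}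

lemma tendsto_integral_linPart (ha : a ≠ 0) (hxy : x ≠ y) :
    ∃ L : ℂ, Tendsto (fun T => ∫ t in (0 : ℝ)..T, linPart a x y t) atTop (𝓝 L) := by
  -- The comparison radius 1 is arbitrary: changing the radius alters `mom 1` by O(t⁻²) only.
  have hc1 : ContinuousOn (fun t => cis (-a * t) * (mom 1 1 t : ℂ)) (Ioi 0) := by
    have := continuous_cis
    exact (Continuous.continuousOn (by fun_prop)).mul
      (Complex.continuous_ofReal.comp_continuousOn (continuousOn_mom 1 1))
  have hi1 : ∀ T, 0 ≤ T →
      IntervalIntegrable (fun t => cis (-a * t) * (mom 1 1 t : ℂ)) volume 0 T := fun T hT =>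
    intervalIntegrable_cis_mul (continuousOn_mom 1 1) (abs_mom_le 1 one_pos) hT
  obtain ⟨L, hL⟩ := tendsto_integral_cis_mul (neg_ne_zero.2 ha)
    (fun t ht => hasDerivAt_mom 1 1 ht) (abs_mom_le 1 one_pos) (hasDerivAt_mom_abs_le 0 one_pos).1
    (tendsto_mom_atTop 0 zero_le_one)
  have hr : IntegrableOn (fun t => linPart a x y t - cis (-a * t) * (mom 1 1 t : ℂ)) (Ioi 0) := by
    refine integrableOn_Ioi_of_decay (C := ((‖x‖ + ‖y‖) ^ 2 + 1) / 4)
      ((continuousOn_linPart a x y).sub hc1)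
      ((intervalIntegrable_linPart a hxy zero_le_one).sub (hi1 1 zero_le_one)) fun t ht => ?_
    have ht0 : 0 < t := by linarith
    rw [linPart, ← mul_sub, norm_mul, norm_cis, one_mul, ← Complex.ofReal_sub, Complex.norm_real]
    refine (mom_lipschitz 1 (by positivity) zero_le_one ht0).trans ?_
    gcongr
    refine (abs_sub _ _).trans ?_
    rw [abs_one, abs_of_nonneg (by positivity)]
    gcongr
    exact norm_rotDiff_le a x y t
  refine ⟨_, ((intervalIntegral_tendsto_integral_Ioi 0 hr tendsto_id).add hL).congr' ?_⟩
  filter_upwards [eventually_ge_atTop 0] with T hT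
  rw [id_eq, ← intervalIntegral.integral_add
    ((intervalIntegrable_linPart a hxy hT).sub (hi1 T hT)) (hi1 T hT)]
  simp

end Coefficients

/-- An improper integral is estimated by splitting off oscillating terms and an integrable
leading term. -/
lemma norm_lim_sub_integral_le {h o₁ o₂ z : ℝ → ℂ} {b : ℝ → ℝ} {L : ℂ} {B₁ B₂ : ℝ}
    (hL : Tendsto (fun T => ∫ t in (0 : ℝ)..T, h t) atTop (𝓝 L))
    (hh : ∀ T, 0 < T → IntervalIntegrable h volume 0 T)
    (ho₁ : ∀ T, 0 < T → IntervalIntegrable o₁ volume 0 T)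
    (ho₂ : ∀ T, 0 < T → IntervalIntegrable o₂ volume 0 T)
    (hz : IntegrableOn z (Ioi 0)) (hb : IntegrableOn b (Ioi 0))
    (hB₁ : ∀ T, 0 < T → ‖∫ t in (0 : ℝ)..T, o₁ t‖ ≤ B₁)
    (hB₂ : ∀ T, 0 < T → ‖∫ t in (0 : ℝ)..T, o₂ t‖ ≤ B₂)
    (hρ : ∀ t, 0 < t → ‖h t - (o₁ t + o₂ t + z t)‖ ≤ b t) :
    ‖L - ∫ t in Ioi (0 : ℝ), z t‖ ≤ B₁ + B₂ + ∫ t in Ioi (0 : ℝ), b t := by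
  refine le_of_tendsto (hL.sub (intervalIntegral_tendsto_integral_Ioi 0 hz tendsto_id)).norm ?_
  filter_upwards [eventually_gt_atTop 0] with T hT
  have hzT : IntervalIntegrable z volume 0 T := by
    rw [intervalIntegrable_iff_integrableOn_Ioc_of_le hT.le]
    exact hz.mono_set Ioc_subset_Ioi_self
  have hbT : IntervalIntegrable b volume 0 T := by
    rw [intervalIntegrable_iff_integrableOn_Ioc_of_le hT.le]
    exact hb.mono_set Ioc_subset_Ioi_self
  have h12 := (ho₁ T hT).add (ho₂ T hT)
  have e : (∫ t in (0 : ℝ)..T, h t) - ∫ t in (0 : ℝ)..T, z t =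
      (∫ t in (0 : ℝ)..T, o₁ t) + (∫ t in (0 : ℝ)..T, o₂ t) +
        ∫ t in (0 : ℝ)..T, (h t - (o₁ t + o₂ t + z t)) := by
    rw [intervalIntegral.integral_sub (hh T hT) (h12.add hzT),
      intervalIntegral.integral_add h12 hzT,
      intervalIntegral.integral_add (ho₁ T hT) (ho₂ T hT)]
    ring
  have hr : ‖∫ t in (0 : ℝ)..T, (h t - (o₁ t + o₂ t + z t))‖ ≤ ∫ t in Ioi (0 : ℝ), b t := by
    refine (intervalIntegral.norm_integral_le_of_norm_le hT.le ?_ hbT).trans ?_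
    · filter_upwards with t ht using hρ t ht.1
    · rw [intervalIntegral.integral_of_le hT.le]
      refine setIntegral_mono_set hb ?_ Ioc_subset_Ioi_self.eventuallyLE
      filter_upwards [ae_restrict_mem measurableSet_Ioi] with t ht
      exact (norm_nonneg _).trans (hρ t ht)
  rw [id_eq, e]
  exact (norm_add₃_le).trans (add_le_add (add_le_add (hB₁ T hT) (hB₂ T hT)) hr)

open ComplexConjugate

lemma conj_cis (θ : ℝ) : conj (cis θ) = cis (-θ) := by
  rw [cis, cis, ← Complex.exp_conj]; simp

/-! ### Asymptotics of the two coefficients for |x| > 2|y| -/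

section Estimates

variable {a : ℝ} {x y : ℂ}

/-- The deviation of `|O(at)x - y|²` from its mean `|x|² + |y|²`. -/
noncomputable def deviation (a : ℝ) (x y : ℂ) (t : ℝ) : ℝ := 2 * (cis (a * t) * x * conj y).re

lemma norm_rotDiff_sq (t : ℝ) :
    ‖rotDiff a x y t‖ ^ 2 = ‖x‖ ^ 2 + ‖y‖ ^ 2 - deviation a x y t := by
  rw [rotDiff, deviation, Complex.sq_norm, Complex.normSq_sub, Complex.normSq_mul,
    ← Complex.sq_norm, ← Complex.sq_norm, ← Complex.sq_norm, norm_cis]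
  ring

lemma deviation_eq (t : ℝ) :
    (deviation a x y t : ℂ) = cis (a * t) * (x * conj y) + cis (-a * t) * (conj x * y) := by
  rw [deviation, ← Complex.add_conj]
  simp only [map_mul, conj_cis, Complex.conj_conj]
  rw [neg_mul]; ring

lemma abs_deviation_le (t : ℝ) : |deviation a x y t| ≤ 2 * (‖x‖ * ‖y‖) := by
  rw [deviation, abs_mul, abs_two]
  gcongr
  refine (Complex.abs_re_le_norm _).trans (le_of_eq ?_)
  simp

/-- The right side is at least (|x| - |y|)² ≥ (|x|/2)². This provides the radius |x|²/4 for all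
Taylor remainders. -/
lemma quarter_le_sub_deviation (h : 2 * ‖y‖ ≤ ‖x‖) (t : ℝ) :
    ‖x‖ ^ 2 / 4 ≤ ‖x‖ ^ 2 + ‖y‖ ^ 2 - |deviation a x y t| := by
  have := abs_deviation_le (a := a) (x := x) (y := y) t
  nlinarith [norm_nonneg x, norm_nonneg y]

lemma mul_conj_cast (x : ℂ) : x * conj x = ((‖x‖ ^ 2 : ℝ) : ℂ) := by
  rw [Complex.mul_conj, Complex.normSq_eq_norm_sq]

/-- Second-order expansion in the deviation. Of its two phases, e^{iat} cancels the prefactor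
e^{-iat} and leaves the resonant term xȳ/4 · `mom 2`; the other doubles the frequency. -/
lemma norm_linPart_sub_le (h : 2 * ‖y‖ ≤ ‖x‖) {t : ℝ} (ht : 0 < t) :
    ‖linPart a x y t - (cis (-a * t) * (mom 1 (‖x‖ ^ 2 + ‖y‖ ^ 2) t : ℂ) +
      conj x * y / 4 * (cis (-(2 * a) * t) * (mom 2 (‖x‖ ^ 2 + ‖y‖ ^ 2) t : ℂ)) +
      x * conj y / 4 * (mom 2 (‖x‖ ^ 2 + ‖y‖ ^ 2) t : ℂ))‖ ≤
      ‖x‖ ^ 2 * ‖y‖ ^ 2 / 4 * mom 3 (‖x‖ ^ 2 / 4) t := by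
  have hT := mom_taylor_two 1 (quarter_le_sub_deviation (a := a) h t) ht
  have hd := abs_deviation_le (a := a) (x := x) (y := y) t
  have e1 : cis (-(2 * a) * t) = cis (-a * t) * cis (-a * t) := by rw [← cis_add]; ring_nf
  have e2 : cis (-a * t) * cis (a * t) = 1 := by rw [← cis_add]; simp
  have e : linPart a x y t - (cis (-a * t) * (mom 1 (‖x‖ ^ 2 + ‖y‖ ^ 2) t : ℂ) +
      conj x * y / 4 * (cis (-(2 * a) * t) * (mom 2 (‖x‖ ^ 2 + ‖y‖ ^ 2) t : ℂ)) +
      x * conj y / 4 * (mom 2 (‖x‖ ^ 2 + ‖y‖ ^ 2) t : ℂ)) =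
      cis (-a * t) * ((mom 1 (‖x‖ ^ 2 + ‖y‖ ^ 2 - deviation a x y t) t -
        (mom 1 (‖x‖ ^ 2 + ‖y‖ ^ 2) t + deviation a x y t / 4 * mom 2 (‖x‖ ^ 2 + ‖y‖ ^ 2) t) :
          ℝ) : ℂ) := by
    rw [linPart, norm_rotDiff_sq, e1]
    simp only [Complex.ofReal_sub, Complex.ofReal_add, Complex.ofReal_mul, Complex.ofReal_div]
    rw [deviation_eq]
    push_cast
    linear_combination (x * conj y / 4 * (mom 2 (‖x‖ ^ 2 + ‖y‖ ^ 2) t : ℂ)) * e2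
  rw [e, norm_mul, norm_cis, one_mul, Complex.norm_real]
  refine hT.trans (mul_le_mul_of_nonneg_right ?_ (mom_nonneg _ _ ht))
  have : deviation a x y t ^ 2 ≤ (2 * (‖x‖ * ‖y‖)) ^ 2 := sq_le_sq' (abs_le.1 hd).1 (abs_le.1 hd).2
  linarith

lemma norm_lim_linPart_sub_le (ha : a ≠ 0) (h : 2 * ‖y‖ < ‖x‖) {L : ℂ}
    (hL : Tendsto (fun T => ∫ t in (0 : ℝ)..T, linPart a x y t) atTop (𝓝 L)) :
    ‖L - x * conj y / (‖x‖ ^ 2 : ℝ)‖ ≤ 65 * (|a|⁻¹ + ‖y‖ ^ 2) / ‖x‖ ^ 2 := by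
  have hx : 0 < ‖x‖ := lt_of_le_of_lt (by positivity) h
  have hxy : x ≠ y := by
    rintro rfl; linarith
  set R : ℝ := ‖x‖ ^ 2 + ‖y‖ ^ 2 with hR_def
  have hR : 0 < R := by positivity
  have hm : 0 < ‖x‖ ^ 2 / 4 := by positivity
  have hν₁ : -a ≠ 0 := neg_ne_zero.2 ha
  have hν₂ : -(2 * a) ≠ 0 := neg_ne_zero.2 (mul_ne_zero two_ne_zero ha)
  have ha' : 0 < |a| := abs_pos.2 ha
  have hz : IntegrableOn (fun t => x * conj y / 4 * (mom 2 R t : ℂ)) (Ioi 0) :=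
    (integrableOn_mom 0 hR).ofReal.const_mul _
  have hb := (integrableOn_mom 1 hm).const_mul (‖x‖ ^ 2 * ‖y‖ ^ 2 / 4)
  have key := norm_lim_sub_integral_le hL (fun T hT => intervalIntegrable_linPart a hxy hT.le)
    (fun T hT => intervalIntegrable_cis_mul (ν := -a) (continuousOn_mom 1 R) (abs_mom_le 1 hR)
      hT.le)
    (fun T hT => (intervalIntegrable_cis_mul (ν := -(2 * a)) (continuousOn_mom 2 R)
      (abs_mom_le 2 hR) hT.le).const_mul (conj x * y / 4)) hz hb
    (fun T hT => norm_integral_cis_mul_mom_le 0 hR hν₁ hT)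
    (B₂ := ‖x‖ * ‖y‖ / 4 * (6 * ((1 + 1).factorial * (4 / R) ^ (1 + 1)) / |-(2 * a)|))
    (fun T hT => by
      rw [intervalIntegral.integral_const_mul, norm_mul]
      refine mul_le_mul (by simp) (norm_integral_cis_mul_mom_le 1 hR hν₂ hT) (norm_nonneg _)
        (by positivity))
    (fun t ht => norm_linPart_sub_le h.le ht)
  rw [integral_const_mul, integral_const_mul, integral_complex_ofReal, integral_mom 0 hR,
    integral_mom 1 hm, abs_neg, abs_neg, abs_mul, abs_two] at key
  have hxR : ‖x‖ ^ 2 ≤ R := by rw [hR_def]; linarith [sq_nonneg ‖y‖]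
  have hXY : ‖x‖ * ‖y‖ ≤ R / 2 := by rw [hR_def]; nlinarith [sq_nonneg (‖x‖ - ‖y‖)]
  have hX2 : 0 < ‖x‖ ^ 2 := by positivity
  have b₁ : 6 * ((0 + 1).factorial * (4 / R) ^ (0 + 1)) / |a| ≤ 24 * (|a|⁻¹ / ‖x‖ ^ 2) := by
    calc _ = 24 * (|a|⁻¹ / R) := by simp [Nat.factorial]; field_simp; norm_num
      _ ≤ _ := by gcongr
  have b₂ : ‖x‖ * ‖y‖ / 4 * (6 * ((1 + 1).factorial * (4 / R) ^ (1 + 1)) / (2 * |a|)) ≤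
      12 * (|a|⁻¹ / ‖x‖ ^ 2) := by
    calc _ ≤ R / 2 / 4 * (6 * ((1 + 1).factorial * (4 / R) ^ (1 + 1)) / (2 * |a|)) := by gcongr
      _ = 12 * (|a|⁻¹ / R) := by simp [Nat.factorial]; field_simp; norm_num
      _ ≤ _ := by gcongr
  have b₃ : ‖x‖ ^ 2 * ‖y‖ ^ 2 / 4 * (Nat.factorial 1 * (4 / (‖x‖ ^ 2 / 4)) ^ (1 + 1)) =
      64 * (‖y‖ ^ 2 / ‖x‖ ^ 2) := by
    simp [Nat.factorial]; field_simp; norm_num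
  have e₁ : x * conj y / 4 * ((Nat.factorial 0 * (4 / R) ^ (0 + 1) : ℝ) : ℂ) =
      x * conj y / (R : ℂ) := by
    have : (R : ℂ) ≠ 0 := by exact_mod_cast hR.ne'
    simp [Nat.factorial]; field_simp
  -- Cost of replacing R by |x|² in the leading term; added to the 64 of `b₃` it gives 65.
  have b₄ : ‖x * conj y / (R : ℂ) - x * conj y / (‖x‖ ^ 2 : ℝ)‖ ≤ ‖y‖ ^ 2 / ‖x‖ ^ 2 := by
    have e : x * conj y / (R : ℂ) - x * conj y / (‖x‖ ^ 2 : ℝ) =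
        x * conj y * ((1 / R - 1 / ‖x‖ ^ 2 : ℝ) : ℂ) := by push_cast; ring
    have e' : 1 / R - 1 / ‖x‖ ^ 2 = -(‖y‖ ^ 2 / (R * ‖x‖ ^ 2)) := by
      rw [hR_def] at hR ⊢; field_simp; ring
    rw [e, e', norm_mul, norm_mul, Complex.norm_real, norm_neg, Complex.norm_conj,
      Real.norm_of_nonneg (by positivity)]
    calc _ ≤ R * (‖y‖ ^ 2 / (R * ‖x‖ ^ 2)) := by gcongr; linarith
      _ = _ := by field_simp
  rw [e₁, b₃] at key
  calc _ ≤ ‖L - x * conj y / (R : ℂ)‖ + ‖x * conj y / (R : ℂ) - x * conj y / (‖x‖ ^ 2 : ℝ)‖ :=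
        norm_sub_le_norm_sub_add_norm_sub _ _ _
    _ ≤ 65 * (|a|⁻¹ / ‖x‖ ^ 2) + 65 * (‖y‖ ^ 2 / ‖x‖ ^ 2) := by
        have : 0 ≤ |a|⁻¹ / ‖x‖ ^ 2 := by positivity
        linarith
    _ = _ := by ring

/-- Since e^{-iat}(e^{iat}x - y)² = e^{iat}x² - 2xy + e^{-iat}y², the tail is expanded to second
order against x², to first order against xy, and not at all against y². Each of the three errors
then carries exactly |y|². The resonant terms come from x² times the e^{-iat} part of the deviation,
and from -2xy. -/
lemma norm_antiPart_sub_le (h : 2 * ‖y‖ ≤ ‖x‖) {t : ℝ} (ht : 0 < t) :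
    ‖antiPart a x y t - (x ^ 2 * (cis (a * t) * (tail 3 (‖x‖ ^ 2 + ‖y‖ ^ 2) t : ℂ)) +
      x ^ 2 * (x * conj y) / 4 * (cis (2 * a * t) * (tail 4 (‖x‖ ^ 2 + ‖y‖ ^ 2) t : ℂ)) +
      (x ^ 2 * (conj x * y) / 4 * (tail 4 (‖x‖ ^ 2 + ‖y‖ ^ 2) t : ℂ) -
        2 * x * y * (tail 3 (‖x‖ ^ 2 + ‖y‖ ^ 2) t : ℂ)))‖ ≤
      ‖x‖ ^ 4 * ‖y‖ ^ 2 / 4 * tail 5 (‖x‖ ^ 2 / 4) t +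
        ‖x‖ ^ 2 * ‖y‖ ^ 2 * tail 4 (‖x‖ ^ 2 / 4) t + ‖y‖ ^ 2 * tail 3 (‖x‖ ^ 2 / 4) t := by
  have hm := quarter_le_sub_deviation (a := a) h t
  have hm0 : 0 ≤ ‖x‖ ^ 2 / 4 := by positivity
  have hT2 := tail_taylor_two 1 hm0 hm ht
  have hT1 := tail_taylor_one 1 hm0 hm ht
  have hT0 := tail_anti 1 hm0 (hm.trans (sub_le_sub_left (le_abs_self _) _)) ht
  have hd := abs_deviation_le (a := a) (x := x) (y := y) t
  have n3 := tail_nonneg 3 (‖x‖ ^ 2 / 4) ht.le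
  have n4 := tail_nonneg 4 (‖x‖ ^ 2 / 4) ht.le
  have n5 := tail_nonneg 5 (‖x‖ ^ 2 / 4) ht.le
  have e1 : cis (2 * a * t) = cis (a * t) * cis (a * t) := by rw [← cis_add]; ring_nf
  have e2 : cis (-a * t) * cis (a * t) = 1 := by rw [← cis_add]; simp
  have e : antiPart a x y t - (x ^ 2 * (cis (a * t) * (tail 3 (‖x‖ ^ 2 + ‖y‖ ^ 2) t : ℂ)) +
      x ^ 2 * (x * conj y) / 4 * (cis (2 * a * t) * (tail 4 (‖x‖ ^ 2 + ‖y‖ ^ 2) t : ℂ)) +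
      (x ^ 2 * (conj x * y) / 4 * (tail 4 (‖x‖ ^ 2 + ‖y‖ ^ 2) t : ℂ) -
        2 * x * y * (tail 3 (‖x‖ ^ 2 + ‖y‖ ^ 2) t : ℂ))) =
      cis (a * t) * x ^ 2 * ((tail 3 (‖x‖ ^ 2 + ‖y‖ ^ 2 - deviation a x y t) t -
        (tail 3 (‖x‖ ^ 2 + ‖y‖ ^ 2) t +
          deviation a x y t / 4 * tail 4 (‖x‖ ^ 2 + ‖y‖ ^ 2) t) : ℝ) : ℂ) -
      2 * x * y * ((tail 3 (‖x‖ ^ 2 + ‖y‖ ^ 2 - deviation a x y t) t -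
        tail 3 (‖x‖ ^ 2 + ‖y‖ ^ 2) t : ℝ) : ℂ) +
      cis (-a * t) * y ^ 2 * (tail 3 (‖x‖ ^ 2 + ‖y‖ ^ 2 - deviation a x y t) t : ℂ) := by
    rw [antiPart, norm_rotDiff_sq, e1, rotDiff]
    simp only [Complex.ofReal_sub, Complex.ofReal_add, Complex.ofReal_mul, Complex.ofReal_div]
    generalize tail 3 (‖x‖ ^ 2 + ‖y‖ ^ 2 - deviation a x y t) t = s
    rw [deviation_eq]
    push_cast
    linear_combination ((s : ℂ) * (cis (a * t) * x ^ 2 - 2 * x * y) +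
      x ^ 2 * (conj x * y) / 4 * (tail 4 (‖x‖ ^ 2 + ‖y‖ ^ 2) t : ℂ)) * e2
  have hds : deviation a x y t ^ 2 ≤ (2 * (‖x‖ * ‖y‖)) ^ 2 :=
    sq_le_sq' (abs_le.1 hd).1 (abs_le.1 hd).2
  rw [e]
  refine (norm_add_le _ _).trans (add_le_add ((norm_sub_le _ _).trans (add_le_add ?_ ?_)) ?_)
  · simp only [norm_mul, norm_pow, norm_cis, Complex.norm_real, one_mul, Real.norm_eq_abs]
    calc _ ≤ ‖x‖ ^ 2 * (deviation a x y t ^ 2 / 16 * tail 5 (‖x‖ ^ 2 / 4) t) := by gcongr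
      _ ≤ ‖x‖ ^ 2 * ((2 * (‖x‖ * ‖y‖)) ^ 2 / 16 * tail 5 (‖x‖ ^ 2 / 4) t) := by gcongr
      _ = _ := by ring
  · simp only [norm_mul, Complex.norm_real, Real.norm_eq_abs, Complex.norm_ofNat]
    calc _ ≤ 2 * ‖x‖ * ‖y‖ * (|deviation a x y t| / 4 * tail 4 (‖x‖ ^ 2 / 4) t) := by gcongr
      _ ≤ 2 * ‖x‖ * ‖y‖ * (2 * (‖x‖ * ‖y‖) / 4 * tail 4 (‖x‖ ^ 2 / 4) t) := by gcongr
      _ = _ := by ring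
  · simp only [norm_mul, norm_pow, norm_cis, Complex.norm_real, one_mul]
    rw [Real.norm_of_nonneg (tail_nonneg _ _ ht.le)]
    gcongr

lemma norm_lim_antiPart_sub_le (ha : a ≠ 0) (h : 2 * ‖y‖ < ‖x‖) {L : ℂ}
    (hL : Tendsto (fun T => ∫ t in (0 : ℝ)..T, antiPart a x y t) atTop (𝓝 L)) :
    ‖L - -(4 * (x * y)) / (‖x‖ ^ 2 : ℝ)‖ ≤ 2321 * (|a|⁻¹ + ‖y‖ ^ 2) / ‖x‖ ^ 2 := by
  have hx : 0 < ‖x‖ := lt_of_le_of_lt (by positivity) h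
  have hxy : x ≠ y := by
    rintro rfl; linarith
  set R : ℝ := ‖x‖ ^ 2 + ‖y‖ ^ 2 with hR_def
  have hR : 0 < R := by positivity
  have hm : 0 < ‖x‖ ^ 2 / 4 := by positivity
  have hν₂ : 2 * a ≠ 0 := mul_ne_zero two_ne_zero ha
  have ha' : 0 < |a| := abs_pos.2 ha
  have hz1 : IntegrableOn (fun t => x ^ 2 * (conj x * y) / 4 * (tail 4 R t : ℂ)) (Ioi 0) :=
    (integrableOn_integral_tail 1 hR).1.ofReal.const_mul _
  have hz2 : IntegrableOn (fun t => 2 * x * y * (tail 3 R t : ℂ)) (Ioi 0) :=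
    (integrableOn_integral_tail 0 hR).1.ofReal.const_mul _
  have hb1 := (integrableOn_integral_tail 2 hm).1.const_mul (‖x‖ ^ 4 * ‖y‖ ^ 2 / 4)
  have hb2 := (integrableOn_integral_tail 1 hm).1.const_mul (‖x‖ ^ 2 * ‖y‖ ^ 2)
  have hb3 := (integrableOn_integral_tail 0 hm).1.const_mul (‖y‖ ^ 2)
  have key := norm_lim_sub_integral_le hL (fun T hT => intervalIntegrable_antiPart a hxy hT.le)
    (fun T hT => (intervalIntegrable_cis_mul (ν := a) (continuousOn_tail 1 hR.le)
      (abs_tail_le 1 hR) hT.le).const_mul (x ^ 2))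
    (fun T hT => (intervalIntegrable_cis_mul (ν := 2 * a) (continuousOn_tail 2 hR.le)
      (abs_tail_le 2 hR) hT.le).const_mul (x ^ 2 * (x * conj y) / 4))
    (hz1.sub hz2) ((hb1.add hb2).add hb3)
    (B₁ := ‖x‖ ^ 2 * (4 * (Nat.factorial 1 * (4 / R) ^ (1 + 1)) / |a|))
    (fun T hT => by
      rw [intervalIntegral.integral_const_mul, norm_mul]
      refine mul_le_mul (by simp) (norm_integral_cis_mul_tail_le 1 hR ha hT) (norm_nonneg _)
        (by positivity))
    (B₂ := ‖x‖ ^ 2 * (‖x‖ * ‖y‖) / 4 * (4 * (Nat.factorial 2 * (4 / R) ^ (2 + 1)) / |2 * a|))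
    (fun T hT => by
      rw [intervalIntegral.integral_const_mul, norm_mul]
      refine mul_le_mul (by simp) (norm_integral_cis_mul_tail_le 2 hR hν₂ hT) (norm_nonneg _)
        (by positivity))
    (fun t ht => norm_antiPart_sub_le h.le ht)
  simp only [Pi.add_apply, Pi.sub_apply] at key
  rw [integral_sub hz1 hz2, integral_add (by exact hb1.add hb2) hb3, integral_add hb1 hb2,
    integral_const_mul, integral_const_mul,
    integral_const_mul, integral_const_mul, integral_const_mul, integral_complex_ofReal,
    integral_complex_ofReal, (integrableOn_integral_tail 1 hR).2,
    (integrableOn_integral_tail 0 hR).2, (integrableOn_integral_tail 0 hm).2,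
    (integrableOn_integral_tail 1 hm).2, (integrableOn_integral_tail 2 hm).2, abs_mul,
    abs_two] at key
  have hxR : ‖x‖ ^ 2 ≤ R := by rw [hR_def]; linarith [sq_nonneg ‖y‖]
  have hXY : ‖x‖ * ‖y‖ ≤ R / 2 := by rw [hR_def]; nlinarith [sq_nonneg (‖x‖ - ‖y‖)]
  have hX2 : 0 < ‖x‖ ^ 2 := by positivity
  have b₁ : ‖x‖ ^ 2 * (4 * (Nat.factorial 1 * (4 / R) ^ (1 + 1)) / |a|) ≤
      64 * (|a|⁻¹ / ‖x‖ ^ 2) := by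
    calc _ ≤ R * (4 * (Nat.factorial 1 * (4 / R) ^ (1 + 1)) / |a|) := by gcongr
      _ = 64 * (|a|⁻¹ / R) := by simp [Nat.factorial]; field_simp; norm_num
      _ ≤ _ := by gcongr
  have b₂ : ‖x‖ ^ 2 * (‖x‖ * ‖y‖) / 4 *
      (4 * (Nat.factorial 2 * (4 / R) ^ (2 + 1)) / (2 * |a|)) ≤ 32 * (|a|⁻¹ / ‖x‖ ^ 2) := by
    calc _ ≤ R * (R / 2) / 4 * (4 * (Nat.factorial 2 * (4 / R) ^ (2 + 1)) / (2 * |a|)) := by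
          gcongr
      _ = 32 * (|a|⁻¹ / R) := by simp [Nat.factorial]; field_simp; norm_num
      _ ≤ _ := by gcongr
  have b₃ : ‖x‖ ^ 4 * ‖y‖ ^ 2 / 4 * (Nat.factorial 2 * (4 / (‖x‖ ^ 2 / 4)) ^ (2 + 1)) +
      ‖x‖ ^ 2 * ‖y‖ ^ 2 * (Nat.factorial 1 * (4 / (‖x‖ ^ 2 / 4)) ^ (1 + 1)) +
      ‖y‖ ^ 2 * (Nat.factorial 0 * (4 / (‖x‖ ^ 2 / 4)) ^ (0 + 1)) =
      2320 * (‖y‖ ^ 2 / ‖x‖ ^ 2) := by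
    simp [Nat.factorial]; field_simp; ring
  have e₁ : x ^ 2 * (conj x * y) / 4 * ((Nat.factorial 1 * (4 / R) ^ (1 + 1) : ℝ) : ℂ) -
      2 * x * y * ((Nat.factorial 0 * (4 / R) ^ (0 + 1) : ℝ) : ℂ) =
      x * y * ((4 * ‖x‖ ^ 2 / R ^ 2 - 8 / R : ℝ) : ℂ) := by
    have hc := mul_conj_cast x
    have : (R : ℂ) ≠ 0 := by exact_mod_cast hR.ne'
    simp only [Nat.factorial]
    push_cast at hc ⊢
    field_simp
    linear_combination 4 * x * y * hc
  have b₄ : ‖x * y * ((4 * ‖x‖ ^ 2 / R ^ 2 - 8 / R : ℝ) : ℂ) - -(4 * (x * y)) / (‖x‖ ^ 2 : ℝ)‖ ≤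
      ‖y‖ ^ 2 / ‖x‖ ^ 2 := by
    have e : x * y * ((4 * ‖x‖ ^ 2 / R ^ 2 - 8 / R : ℝ) : ℂ) - -(4 * (x * y)) / (‖x‖ ^ 2 : ℝ) =
        x * y * ((4 * ‖x‖ ^ 2 / R ^ 2 - 8 / R + 4 / ‖x‖ ^ 2 : ℝ) : ℂ) := by push_cast; ring
    -- A perfect square: the left side is 4(R - |x|²)²/(R²|x|²).
    have e' : 4 * ‖x‖ ^ 2 / R ^ 2 - 8 / R + 4 / ‖x‖ ^ 2 = 4 * ‖y‖ ^ 4 / (R ^ 2 * ‖x‖ ^ 2) := by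
      rw [hR_def] at hR ⊢; field_simp; ring
    have hy : 4 * ‖y‖ ^ 2 ≤ R := by
      rw [hR_def]; nlinarith [norm_nonneg y]
    rw [e, e', norm_mul, norm_mul, Complex.norm_real, Real.norm_of_nonneg (by positivity)]
    calc _ ≤ R * (4 * ‖y‖ ^ 4 / (R ^ 2 * ‖x‖ ^ 2)) := by gcongr; linarith
      _ = ‖y‖ ^ 2 * (4 * ‖y‖ ^ 2) / (R * ‖x‖ ^ 2) := by field_simp
      _ ≤ ‖y‖ ^ 2 * R / (R * ‖x‖ ^ 2) := by gcongr
      _ = _ := by field_simp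
  rw [e₁, b₃] at key
  calc _ ≤ ‖L - x * y * ((4 * ‖x‖ ^ 2 / R ^ 2 - 8 / R : ℝ) : ℂ)‖ + _ :=
        norm_sub_le_norm_sub_add_norm_sub _ _ _
    _ ≤ 2321 * (|a|⁻¹ / ‖x‖ ^ 2) + 2321 * (‖y‖ ^ 2 / ‖x‖ ^ 2) := by
        have : 0 ≤ |a|⁻¹ / ‖x‖ ^ 2 := by positivity
        linarith
    _ = _ := by ring

end Estimates

/-! ### Complex form of matrices, of the Stokes kernel and of the leading term -/

section MatrixForm

/-- The plane as the complex line. -/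
noncomputable def toC (x : Plane) : ℂ := ⟨x 0, x 1⟩

/-- The matrix of the real-linear map `v ↦ p v + q v̄` of the complex line. -/
noncomputable def ofPair (p q : ℂ) : Mat :=
  !![p.re + q.re, q.im - p.im; p.im + q.im, p.re - q.re]

lemma norm_toC (x : Plane) : ‖toC x‖ = ‖x‖ := by
  rw [Complex.norm_eq_sqrt_sq_add_sq, EuclideanSpace.norm_eq]
  simp [toC, Fin.sum_univ_two]

lemma toC_injective : Function.Injective toC := fun x y h => by
  have h0 := congrArg Complex.re h
  have h1 := congrArg Complex.im h
  ext i
  fin_cases i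
  · exact h0
  · exact h1

lemma toC_act_sub (θ : ℝ) (x y : Plane) :
    toC (act (rot θ) x - y) = cis θ * toC x - toC y := by
  rw [cis, Complex.exp_mul_I, ← Complex.ofReal_cos, ← Complex.ofReal_sin]
  apply Complex.ext <;>
    simp [toC, act, rot, dotProduct, Fin.sum_univ_two, -Complex.ofReal_cos,
      -Complex.ofReal_sin] <;> ring

lemma rot_transpose_mul_ofPair (θ : ℝ) (p q : ℂ) :
    (rot θ)ᵀ * ofPair p q = ofPair (cis (-θ) * p) (cis (-θ) * q) := by
  have hr : (cis (-θ)).re = Real.cos θ := by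
    rw [cis, Complex.exp_ofReal_mul_I_re, Real.cos_neg]
  have hi : (cis (-θ)).im = -Real.sin θ := by
    rw [cis, Complex.exp_ofReal_mul_I_im, Real.sin_neg]
  ext i j
  fin_cases i <;> fin_cases j <;>
    simp [ofPair, rot, Matrix.mul_apply, Fin.sum_univ_two, hr, hi] <;> ring

/-- Adjoint for the real inner product Re(u v̄): multiplication by p becomes multiplication by p̄,
while v ↦ q v̄ is symmetric. -/
lemma transpose_ofPair (p q : ℂ) : (ofPair p q)ᵀ = ofPair (conj p) q := by
  ext i j
  fin_cases i <;> fin_cases j <;> simp [ofPair] <;> ring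

lemma ofPair_sub (p q p' q' : ℂ) : ofPair p q - ofPair p' q' = ofPair (p - p') (q - q') := by
  ext i j
  fin_cases i <;> fin_cases j <;> simp [ofPair] <;> ring

/-- The complex-linear and antilinear parts are orthogonal for the Frobenius inner product. -/
lemma norm_sq_ofPair (p q : ℂ) : ‖ofPair p q‖ ^ 2 = 2 * (‖p‖ ^ 2 + ‖q‖ ^ 2) := by
  rw [Matrix.frobenius_norm_def, ← Real.rpow_natCast, ← Real.rpow_mul (by positivity)]
  simp only [Complex.sq_norm, Complex.normSq_apply]
  norm_num [ofPair, Fin.sum_univ_two]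
  ring

lemma norm_le_norm_ofPair (p q : ℂ) : ‖p‖ ≤ ‖ofPair p q‖ := by
  refine le_of_sq_le_sq ?_ (norm_nonneg _)
  rw [norm_sq_ofPair]; nlinarith [sq_nonneg ‖p‖, sq_nonneg ‖q‖]

lemma norm_ofPair_le (p q : ℂ) : ‖ofPair p q‖ ≤ 2 * (‖p‖ + ‖q‖) := by
  refine le_of_sq_le_sq ?_ (by positivity)
  rw [norm_sq_ofPair]
  nlinarith [sq_nonneg ‖p‖, sq_nonneg ‖q‖, mul_nonneg (norm_nonneg p) (norm_nonneg q)]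

lemma heatKernel_eq (z : Plane) (s : ℝ) :
    heatKernel z s = mom 1 (‖z‖ ^ 2) s / (4 * Real.pi) := by
  rw [heatKernel, mom, pow_one]
  rw [show -‖z‖ ^ 2 / (4 * s) = -(‖z‖ ^ 2 * s⁻¹ / 4) by rw [div_eq_mul_inv, mul_inv]; ring]
  rw [div_eq_mul_inv, mul_inv]; ring

lemma heatHessian_apply (z : Plane) (s : ℝ) (i j : Fin 2) :
    heatHessian z s i j = z i * z j / (16 * Real.pi) * mom 3 (‖z‖ ^ 2) s -
      (1 : Mat) i j / (8 * Real.pi) * mom 2 (‖z‖ ^ 2) s := by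
  simp only [heatHessian, heatKernel_eq, tensor, Matrix.smul_apply, Matrix.sub_apply,
    Matrix.vecMulVec_apply, smul_eq_mul, mom, mul_inv, div_eq_mul_inv, inv_pow]
  ring

lemma stokesH_apply (z : Plane) {t : ℝ} (ht : 0 < t) (i j : Fin 2) :
    stokesH z t i j = z i * z j / (16 * Real.pi) * tail 3 (‖z‖ ^ 2) t -
      (1 : Mat) i j / (8 * Real.pi) * tail 2 (‖z‖ ^ 2) t := by
  simp only [stokesH, Matrix.of_apply, heatHessian_apply]
  rw [integral_sub ((integrableOn_mom_Ioi 1 (by positivity) ht).const_mul _)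
    ((integrableOn_mom_Ioi 0 (by positivity) ht).const_mul _), integral_const_mul,
    integral_const_mul]
  rfl

/-- Splitting z ⊗ z into |z|²/2 times the identity and a traceless part gives q. In the identity
part, `mom_one_eq` combines both tails into the heat kernel, so that only half of G remains. -/
lemma stokesK_eq (z : Plane) {t : ℝ} (ht : 0 < t) :
    stokesK z t = ofPair ((mom 1 (‖z‖ ^ 2) t : ℂ) / (8 * Real.pi))
      (toC z ^ 2 * (tail 3 (‖z‖ ^ 2) t : ℂ) / (32 * Real.pi)) := by
  have hr : tail 2 (‖z‖ ^ 2) t = mom 1 (‖z‖ ^ 2) t + ‖z‖ ^ 2 / 4 * tail 3 (‖z‖ ^ 2) t := by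
    rw [mom_one_eq (by positivity) ht]; ring
  have hz : ‖z‖ ^ 2 = z 0 ^ 2 + z 1 ^ 2 := by
    rw [EuclideanSpace.real_norm_sq_eq, Fin.sum_univ_two]
  have e8 : ((mom 1 (‖z‖ ^ 2) t : ℂ) / (8 * Real.pi)) =
      ((mom 1 (‖z‖ ^ 2) t / (8 * Real.pi) : ℝ) : ℂ) := by push_cast; ring
  have e32 : toC z ^ 2 * (tail 3 (‖z‖ ^ 2) t : ℂ) / (32 * Real.pi) =
      toC z ^ 2 * ((tail 3 (‖z‖ ^ 2) t / (32 * Real.pi) : ℝ) : ℂ) := by push_cast; ring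
  rw [e8, e32]
  ext i j
  rw [stokesK, Matrix.add_apply, stokesH_apply z ht, hr, heatKernel_eq]
  generalize mom 1 (‖z‖ ^ 2) t = m
  generalize tail 3 (‖z‖ ^ 2) t = τ
  rw [hz]
  fin_cases i <;> fin_cases j <;>
    simp [ofPair, toC, pow_two, -Complex.ofReal_div, -Complex.ofReal_mul] <;> field_simp <;> ring

lemma integrand_eq (a : ℝ) (x y : Plane) {t : ℝ} (ht : 0 < t) :
    integrand a x y t = ofPair (linPart a (toC x) (toC y) t / (8 * Real.pi))
      (antiPart a (toC x) (toC y) t / (32 * Real.pi)) := by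
  rw [integrand, stokesK_eq _ ht, rot_transpose_mul_ofPair, ← norm_toC, toC_act_sub, linPart,
    antiPart, rotDiff, neg_mul]
  congr 1 <;> ring

/-- As x^⊥ = ix, the matrix x^⊥ ⊗ y^⊥ sends v to ix Re(conj(iy) v) = (xȳ v - xy v̄)/2. -/
lemma leading_eq (x y : Plane) :
    (1 / (4 * Real.pi * ‖x‖ ^ 2)) • tensor (perp x) (perp y) =
      ofPair (toC x * conj (toC y) / (‖toC x‖ ^ 2 : ℝ) / (8 * Real.pi))
        (-(4 * (toC x * toC y)) / (‖toC x‖ ^ 2 : ℝ) / (32 * Real.pi)) := by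
  rw [norm_toC]
  have e8 : toC x * conj (toC y) / (‖x‖ ^ 2 : ℝ) / (8 * Real.pi) =
      toC x * conj (toC y) * ((1 / (4 * Real.pi * ‖x‖ ^ 2) / 2 : ℝ) : ℂ) := by push_cast; ring
  have e32 : -(4 * (toC x * toC y)) / (‖x‖ ^ 2 : ℝ) / (32 * Real.pi) =
      -(toC x * toC y) * ((1 / (4 * Real.pi * ‖x‖ ^ 2) / 2 : ℝ) : ℂ) := by push_cast; ring
  rw [e8, e32]
  generalize 1 / (4 * Real.pi * ‖x‖ ^ 2) = c
  ext i j
  fin_cases i <;> fin_cases j <;> simp [ofPair, toC, perp, tensor] <;> ring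

/-- The entries of `ofPair p q` as continuous linear functionals of `p`. -/
noncomputable def entryLin (i j : Fin 2) : ℂ →L[ℝ] ℝ :=
  LinearMap.toContinuousLinearMap
    { toFun := fun p => ofPair p 0 i j
      map_add' := fun p q => by
        fin_cases i <;> fin_cases j <;> simp [ofPair] <;> ring
      map_smul' := fun c p => by
        fin_cases i <;> fin_cases j <;> simp [ofPair] }

/-- The entries of `ofPair p q` as continuous linear functionals of `q`. -/
noncomputable def entryAnti (i j : Fin 2) : ℂ →L[ℝ] ℝ :=
  LinearMap.toContinuousLinearMap
    { toFun := fun q => ofPair 0 q i j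
      map_add' := fun p q => by
        fin_cases i <;> fin_cases j <;> simp [ofPair] <;> ring
      map_smul' := fun c p => by
        fin_cases i <;> fin_cases j <;> simp [ofPair] }

lemma ofPair_apply (p q : ℂ) (i j : Fin 2) :
    ofPair p q i j = entryLin i j p + entryAnti i j q := by
  change ofPair p q i j = ofPair p 0 i j + ofPair 0 q i j
  fin_cases i <;> fin_cases j <;> simp [ofPair] <;> ring

end MatrixForm

/-! ### Convergence of Γ_a, failure of absolute convergence, and the estimates -/

section Convergence

variable {a : ℝ} {x y : Plane}

lemma intervalIntegrable_and_integral_entry {f g : ℝ → ℂ} {T : ℝ}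
    (hf : IntervalIntegrable f volume 0 T) (hg : IntervalIntegrable g volume 0 T) (i j : Fin 2) :
    IntervalIntegrable (fun t => ofPair (f t) (g t) i j) volume 0 T ∧
      ∫ t in (0 : ℝ)..T, ofPair (f t) (g t) i j =
        ofPair (∫ t in (0 : ℝ)..T, f t) (∫ t in (0 : ℝ)..T, g t) i j := by
  have hf' : IntervalIntegrable (fun t => entryLin i j (f t)) volume 0 T :=
    ⟨(entryLin i j).integrable_comp hf.1, (entryLin i j).integrable_comp hf.2⟩
  have hg' : IntervalIntegrable (fun t => entryAnti i j (g t)) volume 0 T :=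
    ⟨(entryAnti i j).integrable_comp hg.1, (entryAnti i j).integrable_comp hg.2⟩
  simp only [ofPair_apply]
  refine ⟨hf'.add hg', ?_⟩
  rw [intervalIntegral.integral_add hf' hg', (entryLin i j).intervalIntegral_comp_comm hf,
    (entryAnti i j).intervalIntegral_comp_comm hg]

lemma intervalIntegrable_and_integral_integrand (hxy : x ≠ y) {T : ℝ} (hT : 0 ≤ T) (i j : Fin 2) :
    IntervalIntegrable (fun t => integrand a x y t i j) volume 0 T ∧
      ∫ t in (0 : ℝ)..T, integrand a x y t i j =
        ofPair ((∫ t in (0 : ℝ)..T, linPart a (toC x) (toC y) t) / (8 * Real.pi))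
          ((∫ t in (0 : ℝ)..T, antiPart a (toC x) (toC y) t) / (32 * Real.pi)) i j := by
  have hxy' := toC_injective.ne hxy
  have h := intervalIntegrable_and_integral_entry
    ((intervalIntegrable_linPart a hxy' hT).div_const (8 * Real.pi))
    ((intervalIntegrable_antiPart a hxy' hT).div_const (32 * Real.pi)) i j
  have e : ∀ t ∈ Set.uIoc 0 T, integrand a x y t i j =
      ofPair (linPart a (toC x) (toC y) t / (8 * Real.pi))
        (antiPart a (toC x) (toC y) t / (32 * Real.pi)) i j := fun t ht => by
    rw [uIoc_of_le hT] at ht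
    rw [integrand_eq a x y ht.1]
  refine ⟨h.1.congr fun t ht => (e t ht).symm, ?_⟩
  rw [intervalIntegral.integral_congr_ae (ae_of_all _ e), h.2, intervalIntegral.integral_div,
    intervalIntegral.integral_div]

lemma tendsto_integral_integrand (hxy : x ≠ y) {L M : ℂ}
    (hL : Tendsto (fun T => ∫ t in (0 : ℝ)..T, linPart a (toC x) (toC y) t) atTop (𝓝 L))
    (hM : Tendsto (fun T => ∫ t in (0 : ℝ)..T, antiPart a (toC x) (toC y) t) atTop (𝓝 M))
    (i j : Fin 2) :
    Tendsto (fun T : ℝ => ∫ t in (0 : ℝ)..T, integrand a x y t i j) atTop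
      (𝓝 (ofPair (L / (8 * Real.pi)) (M / (32 * Real.pi)) i j)) := by
  have h := ((entryLin i j).continuous.tendsto _ |>.comp (hL.div_const (8 * (Real.pi : ℂ)))).add
    ((entryAnti i j).continuous.tendsto _ |>.comp (hM.div_const (32 * (Real.pi : ℂ))))
  rw [← ofPair_apply] at h
  refine h.congr' ?_
  filter_upwards [eventually_ge_atTop 0] with T hT
  rw [(intervalIntegrable_and_integral_integrand hxy hT i j).2, ofPair_apply]
  rfl

lemma Gam_eq (hxy : x ≠ y) {L M : ℂ}
    (hL : Tendsto (fun T => ∫ t in (0 : ℝ)..T, linPart a (toC x) (toC y) t) atTop (𝓝 L))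
    (hM : Tendsto (fun T => ∫ t in (0 : ℝ)..T, antiPart a (toC x) (toC y) t) atTop (𝓝 M)) :
    Gam a x y = ofPair (L / (8 * Real.pi)) (M / (32 * Real.pi)) := by
  ext i j
  exact (tendsto_integral_integrand hxy hL hM i j).limUnder_eq

lemma tendsto_integral_Gam (ha : a ≠ 0) (hxy : x ≠ y) (i j : Fin 2) :
    Tendsto (fun T : ℝ => ∫ t in (0 : ℝ)..T, integrand a x y t i j) atTop
      (𝓝 (Gam a x y i j)) := by
  obtain ⟨L, hL⟩ := tendsto_integral_linPart ha (toC_injective.ne hxy)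
  obtain ⟨M, hM⟩ := tendsto_integral_antiPart a (toC_injective.ne hxy)
  rw [Gam_eq hxy hL hM]
  exact tendsto_integral_integrand hxy hL hM i j

/-- The complex-linear part alone has modulus at least c/t for t > 1, because |O(at)x - y| ≤ |x| +
|y|. -/
lemma lintegral_enorm_integrand (a : ℝ) (x y : Plane) :
    ∫⁻ t in Ioi (0 : ℝ), ‖integrand a x y t‖ₑ = ⊤ := by
  by_contra hne
  set S : ℝ := (‖toC x‖ + ‖toC y‖) ^ 2
  set c : ℝ := Real.exp (-(S / 4)) / (8 * Real.pi)
  have hc : 0 < c := by positivity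
  have hle : ∀ t ∈ Ioi (1 : ℝ), ‖c * t⁻¹‖ₑ ≤ ‖integrand a x y t‖ₑ := by
    intro t ht
    have ht1 : 1 < t := ht
    have ht0 : 0 < t := by linarith
    rw [enorm_le_iff_norm_le, Real.norm_of_nonneg (by positivity), integrand_eq a x y ht0]
    refine le_trans ?_ (norm_le_norm_ofPair _ _)
    rw [norm_div, norm_linPart _ _ _ ht0]
    have h8 : ‖(8 * Real.pi : ℂ)‖ = 8 * Real.pi := by
      simp [abs_of_pos Real.pi_pos]
    rw [h8, show c * t⁻¹ = Real.exp (-(S / 4)) * t⁻¹ / (8 * Real.pi) by simp only [c]; ring]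
    gcongr
    have h1 : ‖rotDiff a (toC x) (toC y) t‖ ^ 2 ≤ S := by
      exact pow_le_pow_left₀ (norm_nonneg _) (norm_rotDiff_le a (toC x) (toC y) t) 2
    refine le_trans ?_ (mom_anti 1 h1 ht0)
    rw [mom, pow_one, mul_comm]
    have : t⁻¹ ≤ 1 := inv_le_one_of_one_le₀ ht1.le
    have hS : 0 ≤ S := by positivity
    gcongr
    nlinarith
  have hlt : ∫⁻ t in Ioi (1 : ℝ), ‖c * t⁻¹‖ₑ < ⊤ :=
    lt_of_le_of_lt ((setLIntegral_mono' measurableSet_Ioi hle).trans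
      (lintegral_mono_set (Ioi_subset_Ioi zero_le_one))) (lt_top_iff_ne_top.2 hne)
  have hi : IntegrableOn (fun t : ℝ => c * t⁻¹) (Ioi 1) :=
    ⟨(by fun_prop : Measurable fun t : ℝ => c * t⁻¹).aestronglyMeasurable, hlt⟩
  refine not_integrableOn_Ioi_inv (a := 1) (IntegrableOn.congr_fun (hi.const_mul c⁻¹)
    (fun t _ => ?_) measurableSet_Ioi)
  field_simp

lemma norm_Gam_sub_le (ha : a ≠ 0) (h : 2 * ‖y‖ < ‖x‖) :
    ‖Gam a x y - (1 / (4 * Real.pi * ‖x‖ ^ 2)) • tensor (perp x) (perp y)‖ ≤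
      4772 * (|a|⁻¹ + ‖y‖ ^ 2) / ‖x‖ ^ 2 := by
  have hxy : x ≠ y := by
    rintro rfl; linarith [norm_nonneg x]
  have hc : 2 * ‖toC y‖ < ‖toC x‖ := by simpa only [norm_toC] using h
  obtain ⟨L, hL⟩ := tendsto_integral_linPart ha (toC_injective.ne hxy)
  obtain ⟨M, hM⟩ := tendsto_integral_antiPart a (toC_injective.ne hxy)
  have h1 := norm_lim_linPart_sub_le ha hc hL
  have h2 := norm_lim_antiPart_sub_le ha hc hM
  rw [Gam_eq hxy hL hM, leading_eq, ofPair_sub, ← sub_div, ← sub_div]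
  refine (norm_ofPair_le _ _).trans ?_
  have h8 : ‖(8 * Real.pi : ℂ)‖ = 8 * Real.pi := by simp [abs_of_pos Real.pi_pos]
  have h32 : ‖(32 * Real.pi : ℂ)‖ = 32 * Real.pi := by simp [abs_of_pos Real.pi_pos]
  rw [norm_div, norm_div, h8, h32]
  have i1 := div_le_self (norm_nonneg (L - toC x * conj (toC y) / (‖toC x‖ ^ 2 : ℝ)))
    (by linarith [Real.pi_gt_three] : 1 ≤ 8 * Real.pi)
  have i2 := div_le_self (norm_nonneg (M - -(4 * (toC x * toC y)) / (‖toC x‖ ^ 2 : ℝ)))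
    (by linarith [Real.pi_gt_three] : 1 ≤ 32 * Real.pi)
  simp only [norm_toC] at *
  -- 4772 = 2(65 + 2321), after the factors 1/(8π) and 1/(32π) are bounded by 1.
  calc _ ≤ 2 * (65 * (|a|⁻¹ + ‖y‖ ^ 2) / ‖x‖ ^ 2 + 2321 * (|a|⁻¹ + ‖y‖ ^ 2) / ‖x‖ ^ 2) := by
        linarith
    _ = _ := by ring

/-- Basis of the symmetry between x and y: exchanging them and reversing the rotation changes the
difference only by a unit factor, so its modulus is preserved. -/
lemma rotDiff_neg_swap (a : ℝ) (x y : ℂ) (t : ℝ) :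
    rotDiff (-a) y x t = -(cis (-a * t) * rotDiff a x y t) := by
  have e : cis (-a * t) * cis (a * t) = 1 := by rw [← cis_add]; simp
  rw [rotDiff, rotDiff]
  linear_combination x * e

lemma linPart_neg_swap (a : ℝ) (x y : ℂ) (t : ℝ) :
    linPart (-a) y x t = conj (linPart a x y t) := by
  rw [linPart, linPart, rotDiff_neg_swap, norm_neg, norm_mul, norm_cis, one_mul, map_mul, conj_cis,
    Complex.conj_ofReal]
  ring_nf

lemma antiPart_neg_swap (a : ℝ) (x y : ℂ) (t : ℝ) :
    antiPart (-a) y x t = antiPart a x y t := by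
  have e : cis (- -a * t) * cis (-a * t) = 1 := by rw [← cis_add]; simp
  rw [antiPart, antiPart, rotDiff_neg_swap, norm_neg, norm_mul, norm_cis, one_mul]
  linear_combination (cis (-a * t) * rotDiff a x y t ^ 2 *
    (tail 3 (‖rotDiff a x y t‖ ^ 2) t : ℂ)) * e

lemma integrand_neg_swap (a : ℝ) (x y : Plane) {t : ℝ} (ht : 0 < t) :
    (integrand (-a) y x t)ᵀ = integrand a x y t := by
  rw [integrand_eq _ _ _ ht, integrand_eq _ _ _ ht, transpose_ofPair, linPart_neg_swap,
    antiPart_neg_swap, map_div₀, Complex.conj_conj]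
  simp [map_ofNat]

lemma Gam_neg_swap (ha : a ≠ 0) (hxy : x ≠ y) : (Gam (-a) y x)ᵀ = Gam a x y := by
  ext i j
  refine tendsto_nhds_unique ?_ (tendsto_integral_Gam ha hxy i j)
  refine (tendsto_integral_Gam (neg_ne_zero.2 ha) hxy.symm j i).congr' ?_
  filter_upwards [eventually_ge_atTop 0] with T hT
  refine intervalIntegral.integral_congr_ae (ae_of_all _ fun t ht => ?_)
  rw [uIoc_of_le hT] at ht
  rw [← integrand_neg_swap a x y ht.1, Matrix.transpose_apply]

lemma norm_Gam_sub_le' (ha : a ≠ 0) (h : 2 * ‖x‖ < ‖y‖) :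
    ‖Gam a x y - (1 / (4 * Real.pi * ‖y‖ ^ 2)) • tensor (perp x) (perp y)‖ ≤
      4772 * (|a|⁻¹ + ‖x‖ ^ 2) / ‖y‖ ^ 2 := by
  have hxy : x ≠ y := by
    rintro rfl; linarith [norm_nonneg x]
  have h1 := norm_Gam_sub_le (neg_ne_zero.2 ha) h
  rw [abs_neg, ← Matrix.frobenius_norm_transpose, Matrix.transpose_sub, Gam_neg_swap ha hxy,
    Matrix.transpose_smul, tensor, Matrix.transpose_vecMulVec] at h1
  exact h1

end Convergence

end RotStokes

theorem proposition3p4 :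
    -- for `x ≠ y` the improper integral converges, but not absolutely
    (∀ a : ℝ, a ≠ 0 → ∀ x y : RotStokes.Plane, x ≠ y →
      (∀ i j : Fin 2,
        (∀ T : ℝ, 0 < T →
          IntervalIntegrable (fun t => RotStokes.integrand a x y t i j) volume 0 T) ∧
        Tendsto (fun T : ℝ => ∫ t in (0 : ℝ)..T, RotStokes.integrand a x y t i j) atTop
          (𝓝 (RotStokes.Gam a x y i j))) ∧
      ∫⁻ t in Ioi (0 : ℝ), ‖RotStokes.integrand a x y t‖ₑ = ⊤) ∧
    -- the estimate for `|x| > 2|y|`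
    (∃ C : ℝ, 0 < C ∧ ∀ a : ℝ, a ≠ 0 → ∀ x y : RotStokes.Plane, 2 * ‖y‖ < ‖x‖ →
      ‖RotStokes.Gam a x y -
          (1 / (4 * Real.pi * ‖x‖ ^ 2)) • RotStokes.tensor (RotStokes.perp x) (RotStokes.perp y)‖
        ≤ C * (|a|⁻¹ + ‖y‖ ^ 2) / ‖x‖ ^ 2) ∧
    -- the expansion as `|x| → ∞`, uniformly in `|y| ≤ ρ`
    (∀ a : ℝ, a ≠ 0 → ∀ ρ : ℝ, 0 < ρ →
      (fun p : RotStokes.Plane × RotStokes.Plane => RotStokes.Gam a p.1 p.2 -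
          (1 / (4 * Real.pi * ‖p.1‖ ^ 2)) •
            RotStokes.tensor (RotStokes.perp p.1) (RotStokes.perp p.2))
        =O[Bornology.cobounded RotStokes.Plane ×ˢ 𝓟 {y : RotStokes.Plane | ‖y‖ ≤ ρ}]
      (fun p : RotStokes.Plane × RotStokes.Plane => (‖p.1‖ ^ 2)⁻¹)) ∧
    -- the estimate for `|y| > 2|x|`
    (∃ C : ℝ, 0 < C ∧ ∀ a : ℝ, a ≠ 0 → ∀ x y : RotStokes.Plane, 2 * ‖x‖ < ‖y‖ →
      ‖RotStokes.Gam a x y -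
          (1 / (4 * Real.pi * ‖y‖ ^ 2)) • RotStokes.tensor (RotStokes.perp x) (RotStokes.perp y)‖
        ≤ C * (|a|⁻¹ + ‖x‖ ^ 2) / ‖y‖ ^ 2) := by
  refine ⟨fun a ha x y hxy => ⟨fun i j => ⟨fun T hT =>
    (RotStokes.intervalIntegrable_and_integral_integrand hxy hT.le i j).1,
    RotStokes.tendsto_integral_Gam ha hxy i j⟩, RotStokes.lintegral_enorm_integrand a x y⟩,
    ⟨4772, by norm_num, fun a ha x y h => RotStokes.norm_Gam_sub_le ha h⟩, fun a ha ρ hρ => ?_,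
    ⟨4772, by norm_num, fun a ha x y h => RotStokes.norm_Gam_sub_le' ha h⟩⟩
  -- Once |x| > 2ρ ≥ 2|y| the first estimate applies, and |y|² ≤ ρ² makes its constant uniform in y.
  refine IsBigO.of_bound (4772 * (|a|⁻¹ + ρ ^ 2)) ?_
  have h1 : ∀ᶠ x : RotStokes.Plane in Bornology.cobounded RotStokes.Plane, 2 * ρ < ‖x‖ :=
    tendsto_norm_cobounded_atTop.eventually_gt_atTop _
  have h2 : ∀ᶠ y in 𝓟 {y : RotStokes.Plane | ‖y‖ ≤ ρ}, ‖y‖ ≤ ρ := mem_principal_self _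
  filter_upwards [h1.prod_mk h2] with p hp
  refine (RotStokes.norm_Gam_sub_le ha (by linarith [hp.1, hp.2])).trans ?_
  rw [Real.norm_of_nonneg (by positivity), ← div_eq_mul_inv]
  have := hp.2
  gcongr
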